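/- Work with deterministic multi-tape Turing machines (modelled with binary stacks; a tape is a pair of stacks) whose running time is the number of steps, and with instances encoded in binary. An instance of \textsc{Generalized $T$-Coloring} consists of a finite simple graph $G=(V,E)$ with $n=|V|$ vertices, a finite set $t(e)\subseteq\mathbb{N}$ of forbidden distances for each edge $e\in E$, and a number $s\in\mathbb{N}$. The question is whether there is an assignment $c:V\to\{1,\ldots,s\}$ with $|c(u)-c(v)|\notin t(uv)$ for every edge $uv\in E$. Let $r$ be the bit size of the instance, where the graph is given by its adjacency matrix and the elements of the sets $t(e)$ are listed in binary, and let $\ell=\max\bigcup_{e\in E}t(e)$ be the largest forbidden distance ($\ell=0$ if there is none). An instance of \textsc{Dominating Set} consists of a finite simple graph $G$ with $n$ vertices and a number $k\in\mathbb{N}$, and the question is whether there is a set $D$ of at most $k$ vertices such that every vertex belongs to $D$ or has a neighbor in $D$. Suppose that some algorithm solves \textsc{Generalized $T$-Coloring} on every instance within one of the following time bounds, where $p$ is a polynomial with nonnegative integer coefficients: (i) $2^{2^{f(n)}}\cdot p(r)$ for some function $f:\mathbb{N}\to\mathbb{R}$ with $f(n)=o(\sqrt n)$ as $n\to\infty$;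 (ii) $2^{n\cdot f(\ell)}\cdot p(r)$ for some function $f:\mathbb{N}\to\mathbb{R}$ with $f(\ell)=o\left(\log \ell/(\log\log \ell)^2\right)$ as $\ell\to\infty$. Then there are an algorithm and a function $g:\mathbb{N}\to\mathbb{R}$ with $g(n)=o(n)$ as $n\to\infty$ such that the algorithm solves \textsc{Dominating Set} in time at most $2^{g(n)}$ on every instance with $n$ vertices. -/

import Mathlib

open Filter Asymptotics

/-! ### Deterministic machines with a step count -/

/-- A deterministic multi-stack Turing machine: finitely many stacks of bits, finitely many labels,
a finite control memory `σ`, and for each label a statement of Mathlib's `Turing.TM2` model.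
(A two-way infinite tape is a pair of stacks, and larger alphabets are coded by blocks of bits, so
this is the multi-tape Turing machine up to a constant factor in the running time.)
The verdict of a halted computation is read off the control memory by `accept`. -/
structure Machine where
  K : Type
  [decK : DecidableEq K]
  [finK : Fintype K]
  Λ : Type
  [finΛ : Fintype Λ]
  σ : Type
  [finσ : Fintype σ]
  /-- the stack that initially holds the input, all other stacks being empty -/
  input : K
  /-- the label at which the computation starts -/
  main : Λ
  /-- the initial contents of the control memory -/
  init : σ
  accept : σ → Bool
  prog : Λ → Turing.TM2.Stmt (fun _ : K => Bool) Λ σ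

attribute [instance] Machine.decK Machine.finK Machine.finΛ Machine.finσ

namespace Machine

abbrev Cfg (M : Machine) : Type := Turing.TM2.Cfg (fun _ : M.K => Bool) M.Λ M.σ

/-- The initial configuration on input `w`; the first bit of `w` is on top of the input stack. -/
def start (M : Machine) (w : List Bool) : M.Cfg where
  l := some M.main
  var := M.init
  stk := fun k => if k = M.input then w else []

/-- One step of the computation; a halted configuration stays as it is. -/
def next (M : Machine) (c : M.Cfg) : M.Cfg := (Turing.TM2.step M.prog c).getD c

/-- On input `w` the machine halts after at most `T` steps, with verdict `b`. -/
def AnswersWithin (M : Machine) (w : List Bool) (b : Bool) (T : ℕ) : Prop :=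
  (M.next^[T] (M.start w)).l = none ∧ M.accept (M.next^[T] (M.start w)).var = b

end Machine

/-- The machine `M` solves the decision problem `P` on the instance type `I`, where instances are
presented to it through the binary encoding `enc`, and on each instance `x` it makes at most
`time x` steps. -/
def SolvesInTime {I : Type} (M : Machine) (enc : I → List Bool) (P : I → Prop)
    (time : I → ℝ) : Prop :=
  ∀ x : I, ∃ (T : ℕ) (b : Bool),
    (T : ℝ) ≤ time x ∧ M.AnswersWithin (enc x) b T ∧ (b = true ↔ P x)

/-! ### Binary encodings -/

/-- Self-delimiting binary code of a natural number: the binary digits, least significant first,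
each preceded by `true`, and then `false`. It has `2 * (number of digits) + 1` bits. -/
def encodeNumber (m : ℕ) : List Bool :=
  (Nat.bits m).flatMap (fun b => [true, b]) ++ [false]

/-- Self-delimiting code of a finite set of natural numbers: the codes of its elements in increasing
order, each preceded by `true`, and then `false`. -/
def encodeSet (F : Finset ℕ) : List Bool :=
  (F.sort (· ≤ ·)).flatMap (fun d => true :: encodeNumber d) ++ [false]

/-- The entries of an `n × n` matrix of codes, row by row. -/
def encodeMatrix (n : ℕ) (entry : Fin n → Fin n → List Bool) : List Bool :=
  (List.finRange n).flatMap fun u => (List.finRange n).flatMap fun v => entry u v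

/-! ### Generalized T-Coloring -/

/-- An instance of Generalized T-Coloring: a graph `G` on `n` vertices, for each edge the finite set
of forbidden distances, and the number `s` of available colors. -/
structure GTCInstance where
  n : ℕ
  G : SimpleGraph (Fin n)
  t : G.edgeSet → Finset ℕ
  s : ℕ

namespace GTCInstance

/-- `c` is a proper assignment of colors from `{1, …, s}`. -/
def IsProper (x : GTCInstance) (c : Fin x.n → ℕ) : Prop :=
  (∀ v, 1 ≤ c v ∧ c v ≤ x.s) ∧
  ∀ (u v : Fin x.n) (h : x.G.Adj u v), ((c u : ℤ) - (c v : ℤ)).natAbs ∉ x.t ⟨s(u, v), h⟩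

/-- The decision problem: is there a proper assignment? -/
def Positive (x : GTCInstance) : Prop := ∃ c, x.IsProper c

/-- The least `ℓ` such that the instance is `ℓ`-bounded: the largest forbidden distance (a maximum
over a finite set; `0` if no distance is forbidden). -/
noncomputable def bound (x : GTCInstance) : ℕ := sSup {d | ∃ e, d ∈ x.t e}

open Classical in
/-- The number of vertices, the adjacency matrix with the set of forbidden distances at each edge,
and the number of colors. -/
noncomputable def encode (x : GTCInstance) : List Bool :=
  encodeNumber x.n ++
  encodeMatrix x.n (fun u v =>
    if h : x.G.Adj u v then true :: encodeSet (x.t ⟨s(u, v), h⟩) else [false]) ++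
  encodeNumber x.s

/-- The bit size `r` of the instance. -/
noncomputable def bitSize (x : GTCInstance) : ℕ := x.encode.length

end GTCInstance

/-- Generalized T-Coloring is solvable in time `2^(2^(o(√n))) · poly(r)`. -/
def GTCSolvableDoubleExp : Prop :=
  ∃ (M : Machine) (f : ℕ → ℝ) (p : Polynomial ℕ),
    f =o[atTop] (fun n : ℕ => Real.sqrt n) ∧
    SolvesInTime M GTCInstance.encode GTCInstance.Positive
      (fun x => (2 : ℝ) ^ ((2 : ℝ) ^ (f x.n)) * ((p.eval x.bitSize : ℕ) : ℝ))

/-- Generalized T-Coloring is solvable in time `2^(n · o(log ℓ / (log log ℓ)²)) · poly(r)`. -/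
def GTCSolvableBounded : Prop :=
  ∃ (M : Machine) (f : ℕ → ℝ) (p : Polynomial ℕ),
    f =o[atTop] (fun l : ℕ => Real.log l / (Real.log (Real.log l)) ^ 2) ∧
    SolvesInTime M GTCInstance.encode GTCInstance.Positive
      (fun x => (2 : ℝ) ^ ((x.n : ℝ) * f x.bound) * ((p.eval x.bitSize : ℕ) : ℝ))

/-! ### Dominating Set -/

/-- An instance of Dominating Set: a graph `G` on `n` vertices and a number `k`. -/
structure DSInstance where
  n : ℕ
  G : SimpleGraph (Fin n)
  k : ℕ

namespace DSInstance

/-- Is there a set `D` of at most `k` vertices such that each vertex is in `D` or has a neighbor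
in `D`? -/
def Positive (x : DSInstance) : Prop :=
  ∃ D : Finset (Fin x.n), D.card ≤ x.k ∧ ∀ v, v ∈ D ∨ ∃ u ∈ D, x.G.Adj u v

open Classical in
/-- The number of vertices, the adjacency matrix, and `k`. -/
noncomputable def encode (x : DSInstance) : List Bool :=
  encodeNumber x.n ++ encodeMatrix x.n (fun u v => [decide (x.G.Adj u v)]) ++ encodeNumber x.k

end DSInstance

/-- Dominating Set is solvable in time `2^(o(n))`. -/
def DSSolvableSubexp : Prop :=
  ∃ (M : Machine) (g : ℕ → ℝ),
    g =o[atTop] (fun n : ℕ => (n : ℝ)) ∧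
    SolvesInTime M DSInstance.encode DSInstance.Positive (fun x => (2 : ℝ) ^ (g x.n))

/-! Cut the n vertices into p ≈ (log n)² parts of size m ≈ n/(log n)², and view Dominating Set as a
constraint problem with few variables over huge domains. A left variable is the subset chosen inside
one part. A right variable names, for each vertex of one part, a part where a dominating vertex is
to be found; one further right variable assigns to each part a quota, with total at most k. Each
condition then involves a single left and a single right variable.

Such a bipartite constraint problem is a T-coloring problem on 2p + 2 vertices. Measured from a
reference vertex, left values a < 2^m are small offsets and right values b are scaled by 2^(m+1).
The distance 2^(m+1) b ± a determines both a and b whatever the sign (`Red.decode`), so an arbitrary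
relation between a and b can be expressed by forbidden distances. This gives the equivalence
`Red.positive_inst_iff`.

The number of colors is S = 2^(A E) with A of order log n and E of order m, so log S is of order n /
log n. The instance is written down in time polynomial in 2^Q, where Q = A (E + 1) is o(n)
(`Red.Q_isLittleO`). For (i), the target has O((log n)²) vertices, so f is o(log n) there and 2^f is
o(n). For (ii), ℓ = S - 1 and log log ℓ is at least a constant times log n, so the exponent is at
most of order (log n)² · (n / log n) / (log n)² = n / log n.

The remaining work is an honest machine for the translation. Programs `Cmd` are compiled to machines
with an exact step count. Above them are expressions in unary arithmetic whose values are capped at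
a bound B, hence cost poly(B) (`Expr.runsIn_code`), and loops that print words (`Gen.runsIn_code`).
Unary arithmetic is affordable, since B = 2^Q is itself within the time allowed. -/

/-! ### Structured stack programs -/

/-- Structured programs over stacks of bits indexed by `ℕ`. -/
inductive Cmd : Type
  | skip
  | push (k : ℕ) (b : Bool)
  | seq (c₁ c₂ : Cmd)
  /-- pop stack `k`, and run `cn` if it was empty, `c b` if `b` was popped -/
  | case (k : ℕ) (cn : Cmd) (c : Bool → Cmd)
  /-- as long as stack `k` is nonempty, pop a bit `b` from it and run `c b` -/
  | loop (k : ℕ) (c : Bool → Cmd)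

/-- The contents of all stacks. -/
abbrev Store : Type := ℕ → List Bool

namespace Cmd

open Function

/-- Timed big-step semantics. -/
inductive Runs : Cmd → Store → Store → ℕ → Prop
  | skip (s) : Runs skip s s 1
  | push (s k b) : Runs (push k b) s (update s k (b :: s k)) 1
  | seq {c₁ c₂ s s' s'' t t'} : Runs c₁ s s' t → Runs c₂ s' s'' t' → Runs (seq c₁ c₂) s s'' (t + t')
  | case_nil {k cn c s s' t} : s k = [] → Runs cn s s' t → Runs (case k cn c) s s' (t + 1)
  | case_cons {k cn c s s' t b l} : s k = b :: l → Runs (c b) (update s k l) s' t →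
      Runs (case k cn c) s s' (t + 1)
  | loop_nil {k c s} : s k = [] → Runs (loop k c) s s 1
  | loop_cons {k c s s' s'' t t' b l} : s k = b :: l → Runs (c b) (update s k l) s' t →
      Runs (loop k c) s' s'' t' → Runs (loop k c) s s'' (t + t' + 1)

/-- The labels of the compiled program. -/
def Lab : Cmd → Type
  | skip => Unit
  | push _ _ => Unit
  | seq c₁ c₂ => c₁.Lab ⊕ c₂.Lab
  | case _ cn c => Option (cn.Lab ⊕ Σ b, (c b).Lab)
  | loop _ c => Option (Σ b, (c b).Lab)

instance fintypeLab : (c : Cmd) → Fintype c.Lab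
  | skip => inferInstanceAs (Fintype Unit)
  | push _ _ => inferInstanceAs (Fintype Unit)
  | seq c₁ c₂ =>
    letI := fintypeLab c₁
    letI := fintypeLab c₂
    inferInstanceAs (Fintype (c₁.Lab ⊕ c₂.Lab))
  | case _ cn c =>
    letI := fintypeLab cn
    letI := fun b => fintypeLab (c b)
    inferInstanceAs (Fintype (Option (cn.Lab ⊕ Σ b, (c b).Lab)))
  | loop _ c =>
    letI := fun b => fintypeLab (c b)
    inferInstanceAs (Fintype (Option (Σ b, (c b).Lab)))

/-- The label at which a program starts. -/
def entry : (c : Cmd) → c.Lab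
  | skip => ()
  | push _ _ => ()
  | seq c₁ _ => Sum.inl c₁.entry
  | case _ _ _ => none
  | loop _ _ => none

/-- Every stack used by the program has index at most `N`. -/
def KeysLe (N : ℕ) : Cmd → Prop
  | skip => True
  | push k _ => k ≤ N
  | seq c₁ c₂ => c₁.KeysLe N ∧ c₂.KeysLe N
  | case k cn c => k ≤ N ∧ cn.KeysLe N ∧ ∀ b, (c b).KeysLe N
  | loop k c => k ≤ N ∧ ∀ b, (c b).KeysLe N

theorem KeysLe.mono {N N' : ℕ} (h : N ≤ N') : ∀ {c : Cmd}, c.KeysLe N → c.KeysLe N'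
  | skip, _ => trivial
  | push _ _, hc => le_trans hc h
  | seq _ _, hc => ⟨hc.1.mono h, hc.2.mono h⟩
  | case _ _ _, hc => ⟨hc.1.trans h, hc.2.1.mono h, fun b => (hc.2.2 b).mono h⟩
  | loop _ _, hc => ⟨hc.1.trans h, fun b => (hc.2 b).mono h⟩

theorem exists_keysLe : ∀ c : Cmd, ∃ N, c.KeysLe N
  | skip => ⟨0, trivial⟩
  | push k _ => ⟨k, le_refl k⟩
  | seq c₁ c₂ => by
    obtain ⟨N₁, h₁⟩ := exists_keysLe c₁
    obtain ⟨N₂, h₂⟩ := exists_keysLe c₂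
    exact ⟨max N₁ N₂, h₁.mono (le_max_left _ _), h₂.mono (le_max_right _ _)⟩
  | case k cn c => by
    obtain ⟨N₁, h₁⟩ := exists_keysLe cn
    obtain ⟨N₂, h₂⟩ := exists_keysLe (c false)
    obtain ⟨N₃, h₃⟩ := exists_keysLe (c true)
    refine ⟨k + N₁ + N₂ + N₃, by omega, h₁.mono (by omega), fun b => ?_⟩
    cases b
    · exact h₂.mono (by omega)
    · exact h₃.mono (by omega)
  | loop k c => by
    obtain ⟨N₂, h₂⟩ := exists_keysLe (c false)
    obtain ⟨N₃, h₃⟩ := exists_keysLe (c true)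
    refine ⟨k + N₂ + N₃, by omega, fun b => ?_⟩
    cases b
    · exact h₂.mono (by omega)
    · exact h₃.mono (by omega)

/-! ### Compilation of programs to TM2 machines -/

section Compile

variable {K Λ σ : Type} (κ : ℕ → K)

/-- The statements of the compiled program, whose labels are embedded by `e` and which continues
at the label `x`. The first component of the control memory holds the last bit popped. -/
def stmt : (c : Cmd) → (e : c.Lab → Λ) → (x : Λ) → c.Lab →
    Turing.TM2.Stmt (fun _ : K => Bool) Λ (Option Bool × σ)
  | skip, _, x, _ => .goto fun _ => x
  | push k b, _, x, _ => .push (κ k) (fun _ => b) (.goto fun _ => x)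
  | seq c₁ c₂, e, _, Sum.inl l => c₁.stmt (fun l => e (Sum.inl l)) (e (Sum.inr c₂.entry)) l
  | seq _ c₂, e, x, Sum.inr l => c₂.stmt (fun l => e (Sum.inr l)) x l
  | case k cn c, e, _, none => .pop (κ k) (fun v o => (o, v.2)) (.goto fun v =>
      match v.1 with
      | none => e (some (Sum.inl cn.entry))
      | some b => e (some (Sum.inr ⟨b, (c b).entry⟩)))
  | case _ cn _, e, x, some (Sum.inl l) => cn.stmt (fun l => e (some (Sum.inl l))) x l
  | case _ _ c, e, x, some (Sum.inr ⟨b, l⟩) =>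
      (c b).stmt (fun l => e (some (Sum.inr ⟨b, l⟩))) x l
  | loop k c, e, x, none => .pop (κ k) (fun v o => (o, v.2)) (.goto fun v =>
      match v.1 with
      | none => x
      | some b => e (some ⟨b, (c b).entry⟩))
  | loop _ c, e, _, some ⟨b, l⟩ => (c b).stmt (fun l => e (some ⟨b, l⟩)) (e none) l

variable [DecidableEq K]

/-- One step of a machine given by its statements. -/
abbrev nextCfg (prog : Λ → Turing.TM2.Stmt (fun _ : K => Bool) Λ σ)
    (c : Turing.TM2.Cfg (fun _ : K => Bool) Λ σ) : Turing.TM2.Cfg (fun _ : K => Bool) Λ σ :=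
  (Turing.TM2.step prog c).getD c

theorem nextCfg_case {prog : Λ → Turing.TM2.Stmt (fun _ : K => Bool) Λ (Option Bool × σ)}
    {k : ℕ} {cn : Cmd} {c : Bool → Cmd} {e : (case k cn c).Lab → Λ} {x : Λ}
    (hp : ∀ l, prog (e l) = (case k cn c).stmt κ e x l) (o : Option Bool) (v : σ)
    (S : K → List Bool) :
    nextCfg prog ⟨some (e (case k cn c).entry), (o, v), S⟩ =
      ⟨some (match (S (κ k)).head? with
        | none => e (some (Sum.inl cn.entry))
        | some b => e (some (Sum.inr ⟨b, (c b).entry⟩))),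
        ((S (κ k)).head?, v), update S (κ k) (S (κ k)).tail⟩ :=
  (congrArg (fun q => Turing.TM2.stepAux q (o, v) S) (hp (case k cn c).entry)).trans rfl

theorem nextCfg_loop {prog : Λ → Turing.TM2.Stmt (fun _ : K => Bool) Λ (Option Bool × σ)}
    {k : ℕ} {c : Bool → Cmd} {e : (loop k c).Lab → Λ} {x : Λ}
    (hp : ∀ l, prog (e l) = (loop k c).stmt κ e x l) (o : Option Bool) (v : σ)
    (S : K → List Bool) :
    nextCfg prog ⟨some (e (loop k c).entry), (o, v), S⟩ =
      ⟨some (match (S (κ k)).head? with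
        | none => x
        | some b => e (some ⟨b, (c b).entry⟩)),
        ((S (κ k)).head?, v), update S (κ k) (S (κ k)).tail⟩ :=
  (congrArg (fun q => Turing.TM2.stepAux q (o, v) S) (hp (loop k c).entry)).trans rfl

/-- Induction on the run, with the embedding `e` and the exit label `x` general so that subprograms
fit. Each rule is charged exactly the machine steps it causes, so the count `t` is exact. The
component `v` of the control memory is untouched and remains available to the machine run
afterwards. -/
theorem Runs.iterate_next {N : ℕ} {stk : Store → K → List Bool}
    (hget : ∀ s k, k ≤ N → stk s (κ k) = s k)
    (hset : ∀ s k l, k ≤ N → stk (update s k l) = update (stk s) (κ k) l)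
    (prog : Λ → Turing.TM2.Stmt (fun _ : K => Bool) Λ (Option Bool × σ)) (v : σ)
    {c : Cmd} {s s' : Store} {t : ℕ} (hr : Runs c s s' t) :
    ∀ (_ : c.KeysLe N) (e : c.Lab → Λ) (x : Λ) (_ : ∀ l, prog (e l) = c.stmt κ e x l)
      (o : Option Bool), ∃ o',
      (nextCfg prog)^[t] ⟨some (e c.entry), (o, v), stk s⟩ = ⟨some x, (o', v), stk s'⟩ := by
  induction hr with
  | skip s =>
    intro _ e x hp o
    exact ⟨o, by simp [nextCfg, hp, stmt]⟩
  | push s k b =>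
    intro hk e x hp o
    exact ⟨o, by simp [nextCfg, hp, stmt, hset _ _ _ hk, hget _ _ hk]⟩
  | @seq c₁ c₂ s s' s'' t t' _ _ ih₁ ih₂ =>
    intro hk e x hp o
    obtain ⟨o₁, h₁⟩ := ih₁ hk.1 (fun l => e (Sum.inl l)) (e (Sum.inr c₂.entry))
      (fun l => hp (Sum.inl l)) o
    obtain ⟨o₂, h₂⟩ := ih₂ hk.2 (fun l => e (Sum.inr l)) x (fun l => hp (Sum.inr l)) o₁
    refine ⟨o₂, ?_⟩
    rw [add_comm, iterate_add_apply]
    exact (congrArg _ h₁).trans h₂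
  | @case_nil k cn c s s' t h0 _ ih =>
    intro hk e x hp o
    obtain ⟨o', h'⟩ := ih hk.2.1 (fun l => e (some (Sum.inl l))) x
      (fun l => hp (some (Sum.inl l))) none
    refine ⟨o', ?_⟩
    -- Popping an empty stack writes back the empty list.
    have hs : update (stk s) (κ k) [] = stk s := by
      rw [← hset _ _ _ hk.1, ← h0, update_eq_self]
    rw [iterate_add_apply, iterate_one, nextCfg_case κ hp, hget _ _ hk.1, h0, List.tail_nil, hs]
    exact h'
  | @case_cons k cn c s s' t b l h0 _ ih =>
    intro hk e x hp o
    obtain ⟨o', h'⟩ := ih (hk.2.2 b) (fun l => e (some (Sum.inr ⟨b, l⟩))) x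
      (fun l => hp (some (Sum.inr ⟨b, l⟩))) (some b)
    refine ⟨o', ?_⟩
    rw [iterate_add_apply, iterate_one, nextCfg_case κ hp, hget _ _ hk.1, h0, List.tail_cons,
      ← hset _ _ _ hk.1]
    exact h'
  | @loop_nil k c s h0 =>
    intro hk e x hp o
    refine ⟨none, ?_⟩
    have hs : update (stk s) (κ k) [] = stk s := by
      rw [← hset _ _ _ hk.1, ← h0, update_eq_self]
    rw [iterate_one, nextCfg_loop κ hp, hget _ _ hk.1, h0, List.tail_nil, hs]
    rfl
  | @loop_cons k c s s' s'' t t' b l h0 _ _ ih₁ ih₂ =>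
    intro hk e x hp o
    obtain ⟨o₁, h₁⟩ := ih₁ (hk.2 b) (fun l => e (some ⟨b, l⟩)) (e none)
      (fun l => hp (some ⟨b, l⟩)) (some b)
    obtain ⟨o₂, h₂⟩ := ih₂ hk e x hp o₁
    refine ⟨o₂, ?_⟩
    rw [iterate_add_apply, iterate_one, nextCfg_loop κ hp, hget _ _ hk.1, h0, List.tail_cons,
      ← hset _ _ _ hk.1, add_comm, iterate_add_apply]
    exact (congrArg _ h₁).trans h₂

end Compile

end Cmd

/-! ### Running a program before a given machine -/

namespace Machine

open Function

/-- The statements of `M` as part of a machine with more stacks, labels and control memory. -/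
def liftStmt {K K' Λ Λ' σ σ' : Type} :
    Turing.TM2.Stmt (fun _ : K => Bool) Λ σ →
      Turing.TM2.Stmt (fun _ : K ⊕ K' => Bool) (Λ ⊕ Λ') (σ' × σ)
  | .push k f q => .push (Sum.inl k) (fun v => f v.2) (liftStmt q)
  | .peek k f q => .peek (Sum.inl k) (fun v o => (v.1, f v.2 o)) (liftStmt q)
  | .pop k f q => .pop (Sum.inl k) (fun v o => (v.1, f v.2 o)) (liftStmt q)
  | .load f q => .load (fun v => (v.1, f v.2)) (liftStmt q)
  | .branch f q₁ q₂ => .branch (fun v => f v.2) (liftStmt q₁) (liftStmt q₂)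
  | .goto f => .goto (fun v => Sum.inl (f v.2))
  | .halt => .halt

/-- A configuration of `M` as part of a configuration of a larger machine. -/
def liftCfg {K K' Λ Λ' σ σ' : Type} (o : σ') (S' : K' → List Bool)
    (c : Turing.TM2.Cfg (fun _ : K => Bool) Λ σ) :
    Turing.TM2.Cfg (fun _ : K ⊕ K' => Bool) (Λ ⊕ Λ') (σ' × σ) :=
  ⟨c.l.map Sum.inl, (o, c.var), Sum.elim c.stk S'⟩

theorem stepAux_liftStmt {K K' Λ Λ' σ σ' : Type} [DecidableEq K] [DecidableEq K'] (o : σ')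
    (S' : K' → List Bool) (q : Turing.TM2.Stmt (fun _ : K => Bool) Λ σ) :
    ∀ (v : σ) (S : K → List Bool),
      Turing.TM2.stepAux (liftStmt q : Turing.TM2.Stmt (fun _ : K ⊕ K' => Bool) (Λ ⊕ Λ') (σ' × σ))
        (o, v) (Sum.elim S S') = liftCfg o S' (Turing.TM2.stepAux q v S) := by
  induction q with
  | push k f q ih =>
    intro v S
    rw [liftStmt, Turing.TM2.stepAux, Turing.TM2.stepAux, ← ih, ← Sum.update_elim_inl]
    rfl
  | peek k f q ih => intro v S; simp [liftStmt, ← ih]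
  | pop k f q ih =>
    intro v S
    rw [liftStmt, Turing.TM2.stepAux, Turing.TM2.stepAux, ← ih, ← Sum.update_elim_inl]
    rfl
  | load f q ih => intro v S; simp [liftStmt, ← ih]
  | branch f q₁ q₂ ih₁ ih₂ =>
    intro v S
    simp only [liftStmt, Turing.TM2.stepAux, ih₁, ih₂]
    cases f v <;> rfl
  | goto f => intro v S; simp [liftStmt, liftCfg]
  | halt => intro v S; simp [liftStmt, liftCfg]

/-- The machine that runs the program `c`, whose stack `0` is the input stack of `M` and whose
stack `1` holds the input, and then `M`. -/
def precomp (M : Machine) (c : Cmd) (N : ℕ) : Machine where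
  K := M.K ⊕ Fin (N + 1)
  Λ := M.Λ ⊕ c.Lab
  σ := Option Bool × M.σ
  input := Sum.inr 0
  main := Sum.inr c.entry
  init := (none, M.init)
  accept v := M.accept v.2
  prog := Sum.elim (fun l => liftStmt (M.prog l))
    (fun l => c.stmt (fun k => match k with
      | 0 => Sum.inl M.input
      | k + 1 => Sum.inr (Fin.ofNat (N + 1) k)) Sum.inr (Sum.inl M.main) l)

/-- The program touches no stack of `M` except its input stack, so when it stops, the configuration
is a lifted start configuration of `M`. Whatever it leaves on its own stacks is harmless, because
`M` never accesses them. -/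
theorem precomp_answersWithin (M : Machine) (c : Cmd) (N : ℕ) (hN : c.KeysLe N)
    {w w' : List Bool} {s' : Store} {t T : ℕ} {b : Bool}
    (hr : c.Runs (update (fun _ => []) 1 w) s' t) (hs : s' 0 = w') (h : M.AnswersWithin w' b T) :
    (M.precomp c N).AnswersWithin w b (t + T) := by
  let stk : Store → M.K ⊕ Fin (N + 1) → List Bool := fun s =>
    Sum.elim (fun k => if k = M.input then s 0 else []) (fun i => s (i + 1))
  obtain ⟨o, ho⟩ := Cmd.Runs.iterate_next (N := N) (stk := stk)
    (fun k => match k with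
      | 0 => Sum.inl M.input
      | k + 1 => Sum.inr (Fin.ofNat (N + 1) k))
    (by
      intro s k hk
      cases k with
      | zero => simp [stk]
      | succ k => simp [stk, Nat.mod_eq_of_lt (show k < N + 1 by omega)])
    (by
      intro s k l hk
      cases k with
      | zero =>
        funext x
        rcases x with x | x
        · by_cases hx : x = M.input <;> simp [stk, hx]
        · simp [stk]
      | succ k =>
        funext x
        rcases x with x | x
        · simp [stk]
        · simp only [stk, Sum.elim_inr, update_apply, Sum.inr.injEq]
          have : (x : ℕ) + 1 = k + 1 ↔ x = Fin.ofNat (N + 1) k := by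
            rw [Fin.ext_iff, Fin.val_ofNat, Nat.mod_eq_of_lt (show k < N + 1 by omega)]
            omega
          simp only [this])
    (M.precomp c N).prog M.init hr hN Sum.inr (Sum.inl M.main) (fun l => rfl) none
  have h0 : (M.precomp c N).start w = ⟨some (Sum.inr c.entry), (none, M.init),
      stk (update (fun _ => []) 1 w)⟩ := by
    simp only [start, precomp, stk]
    congr 1
    funext x
    rcases x with x | x
    · simp
    · by_cases hx : x = 0
      · subst hx; simp
      · have : (x : ℕ) ≠ 0 := fun h => hx (Fin.ext h)
        simp [hx, update_apply]
  have h1 : (⟨some (Sum.inl M.main), (o, M.init), stk s'⟩ : (M.precomp c N).Cfg) =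
      liftCfg o (fun i : Fin (N + 1) => s' (i + 1)) (M.start w') := by
    simp only [liftCfg, start, stk, hs, Option.map_some]
    rfl
  have h2 : ∀ d : M.Cfg, (M.precomp c N).next (liftCfg o (fun i : Fin (N + 1) => s' (i + 1)) d) =
      liftCfg o (fun i : Fin (N + 1) => s' (i + 1)) (M.next d) := by
    rintro ⟨l, v, S⟩
    cases l with
    | none => rfl
    | some l => exact stepAux_liftStmt o _ (M.prog l) v S
  have h3 : ∀ (n : ℕ) (d : M.Cfg),
      (M.precomp c N).next^[n] (liftCfg o (fun i : Fin (N + 1) => s' (i + 1)) d) =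
      liftCfg o (fun i : Fin (N + 1) => s' (i + 1)) (M.next^[n] d) := by
    intro n
    induction n with
    | zero => intro d; rfl
    | succ n ih =>
      intro d
      exact (congrArg ((M.precomp c N).next^[n]) (h2 d)).trans (ih _)
  have h4 : (M.precomp c N).next^[t + T] ((M.precomp c N).start w) =
      liftCfg o (fun i : Fin (N + 1) => s' (i + 1)) (M.next^[T] (M.start w')) := by
    rw [← h3, add_comm, iterate_add_apply, h0, ← h1]
    exact congrArg _ ho
  unfold AnswersWithin
  rw [h4]
  exact ⟨congrArg (Option.map Sum.inl) h.1, h.2⟩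

end Machine

/-! ### Basic stack programs and their running times -/

namespace Cmd

open Function

/-- `c` takes the store `s` to `s'` within `T` steps. -/
def RunsIn (c : Cmd) (s s' : Store) (T : ℕ) : Prop := ∃ t ≤ T, Runs c s s' t

theorem RunsIn.mono {c : Cmd} {s s' : Store} {T T' : ℕ} (h : RunsIn c s s' T) (hT : T ≤ T') :
    RunsIn c s s' T' :=
  let ⟨t, ht, hr⟩ := h
  ⟨t, ht.trans hT, hr⟩

theorem RunsIn.congr {c : Cmd} {s s' s'' : Store} {T T' : ℕ} (h : RunsIn c s s' T)
    (hs : s' = s'') (hT : T ≤ T') : RunsIn c s s'' T' :=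
  hs ▸ h.mono hT

theorem RunsIn.seq {c₁ c₂ : Cmd} {s s' s'' : Store} {T T' : ℕ} (h₁ : RunsIn c₁ s s' T)
    (h₂ : RunsIn c₂ s' s'' T') : RunsIn (seq c₁ c₂) s s'' (T + T') :=
  let ⟨_, ht₁, hr₁⟩ := h₁
  let ⟨_, ht₂, hr₂⟩ := h₂
  ⟨_, add_le_add ht₁ ht₂, hr₁.seq hr₂⟩

theorem runsIn_skip (s : Store) : RunsIn skip s s 1 := ⟨1, le_rfl, .skip s⟩

theorem runsIn_push (s : Store) (k : ℕ) (b : Bool) :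
    RunsIn (push k b) s (update s k (b :: s k)) 1 := ⟨1, le_rfl, .push s k b⟩

theorem RunsIn.case_nil {k : ℕ} {cn : Cmd} {c : Bool → Cmd} {s s' : Store} {T : ℕ} (hs : s k = [])
    (h : RunsIn cn s s' T) : RunsIn (case k cn c) s s' (T + 1) :=
  let ⟨_, ht, hr⟩ := h
  ⟨_, Nat.succ_le_succ ht, .case_nil hs hr⟩

theorem RunsIn.case_cons {k : ℕ} {cn : Cmd} {c : Bool → Cmd} {s s' : Store} {T : ℕ} {b : Bool}
    {l : List Bool} (hs : s k = b :: l) (h : RunsIn (c b) (update s k l) s' T) :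
    RunsIn (case k cn c) s s' (T + 1) :=
  let ⟨_, ht, hr⟩ := h
  ⟨_, Nat.succ_le_succ ht, .case_cons hs hr⟩

theorem runsIn_loop_nil {k : ℕ} {c : Bool → Cmd} {s : Store} (hs : s k = []) :
    RunsIn (loop k c) s s 1 := ⟨1, le_rfl, .loop_nil hs⟩

theorem RunsIn.loop_cons {k : ℕ} {c : Bool → Cmd} {s s' s'' : Store} {T T' : ℕ} {b : Bool}
    {l : List Bool} (hs : s k = b :: l) (h : RunsIn (c b) (update s k l) s' T)
    (h' : RunsIn (loop k c) s' s'' T') : RunsIn (loop k c) s s'' (T + T' + 1) :=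
  let ⟨_, ht, hr⟩ := h
  let ⟨_, ht', hr'⟩ := h'
  ⟨_, Nat.succ_le_succ (add_le_add ht ht'), .loop_cons hs hr hr'⟩

/-- The unary representation of `n`. -/
abbrev U (n : ℕ) : List Bool := List.replicate n true

/-- The invariant is supplied as the full sequence `S` of stores between rounds. The body starts
after the pop, hence the counter `n - i - 1` in its hypothesis. -/
theorem runsIn_loop_unary {k : ℕ} {c : Bool → Cmd} {T : ℕ} (n : ℕ) (S : ℕ → Store)
    (hk : ∀ i ≤ n, S i k = U (n - i))
    (h : ∀ i < n, RunsIn (c true) (update (S i) k (U (n - i - 1))) (S (i + 1)) T) :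
    RunsIn (loop k c) (S 0) (S n) (n * (T + 1) + 1) := by
  induction n generalizing S with
  | zero => exact (runsIn_loop_nil (by simpa using hk 0 le_rfl)).mono (by omega)
  | succ n ih =>
    have h1 := ih (fun i => S (i + 1)) (fun i hi => by rw [hk _ (by omega)]; congr 1; omega)
      (fun i hi => by
        have := h (i + 1) (by omega)
        rwa [show n + 1 - (i + 1) = n - i by omega] at this)
    have h0 := hk 0 (by omega)
    rw [Nat.sub_zero, U, List.replicate_succ] at h0
    refine (RunsIn.loop_cons h0 (h 0 (by omega)) h1).mono ?_
    ring_nf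
    omega

/-- Empty stack `k`. -/
def clear (k : ℕ) : Cmd := loop k fun _ => skip

theorem runsIn_clear (k : ℕ) : ∀ (l : List Bool) (s : Store), s k = l →
    RunsIn (clear k) s (update s k []) (2 * l.length + 1)
  | [], s, h => by
    rw [← h, update_eq_self]
    exact (runsIn_loop_nil h).mono (by simp)
  | b :: l, s, h => by
    have := RunsIn.loop_cons (c := fun _ => skip) h (runsIn_skip _)
      (runsIn_clear k l (update s k l) (by simp))
    rw [update_idem] at this
    exact this.mono (by simp; omega)

/-- Pour stack `k` onto stack `j`. -/
def move (k j : ℕ) : Cmd := loop k fun b => push j b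

theorem runsIn_move {k j : ℕ} (hkj : k ≠ j) : ∀ (l : List Bool) (s : Store), s k = l →
    RunsIn (move k j) s (update (update s k []) j (l.reverse ++ s j)) (2 * l.length + 1)
  | [], s, h => by
    rw [← h, update_eq_self, h]
    exact (runsIn_loop_nil h).congr (by
      funext x
      simp only [update_apply]
      split_ifs <;> simp_all) (by simp)
  | b :: l, s, h => by
    have := RunsIn.loop_cons (c := fun b => push j b) h (runsIn_push _ _ _)
      (runsIn_move hkj l (update (update s k l) j (b :: update s k l j)) (by simp [hkj]))
    refine this.congr ?_ (by simp; omega)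
    funext x
    simp only [update_apply]
    split_ifs <;> simp_all

/-- Pour stack `k` onto both the stacks `i` and `j`. -/
def dup (k i j : ℕ) : Cmd := loop k fun b => seq (push i b) (push j b)

theorem runsIn_dup {k i j : ℕ} (hki : k ≠ i) (hkj : k ≠ j) (hij : i ≠ j) :
    ∀ (l : List Bool) (s : Store), s k = l → RunsIn (dup k i j) s
      (update (update (update s k []) i (l.reverse ++ s i)) j (l.reverse ++ s j))
      (3 * l.length + 1)
  | [], s, h => by
    rw [← h, update_eq_self, h]
    exact (runsIn_loop_nil h).congr (by
      funext x
      simp only [update_apply]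
      split_ifs <;> simp_all) (by simp)
  | b :: l, s, h => by
    have := RunsIn.loop_cons (c := fun b => seq (push i b) (push j b)) h
      ((runsIn_push _ _ _).seq (runsIn_push _ _ _))
      (runsIn_dup hki hkj hij l _ (by simp [hki, hkj]))
    refine this.congr ?_ (by simp; omega)
    funext x
    simp only [update_apply]
    split_ifs <;> simp_all

/-- Copy stack `k` to the empty stack `j`, using the empty stack `3`. -/
def copy (k j : ℕ) : Cmd := seq (move k 3) (dup 3 k j)

/-- Pouring reverses a stack; doing it twice, through stack 3, restores the order. -/
theorem runsIn_copy {k j : ℕ} (hk : k ≠ 3) (hj : j ≠ 3) (hkj : k ≠ j) (s : Store) (h3 : s 3 = [])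
    (h : s j = []) : RunsIn (copy k j) s (update s j (s k)) (5 * (s k).length + 2) := by
  have := (runsIn_move hk (s k) s rfl).seq
    (runsIn_dup hk.symm hj.symm hkj ((s k).reverse ++ s 3) _ (by simp))
  refine this.congr ?_ (by simp [h3]; omega)
  funext x
  simp only [update_apply]
  split_ifs <;> simp_all

/-- Increment the unary number on stack `d`, but not beyond the one on stack `2`. -/
def inc (d : ℕ) : Cmd :=
  seq (push d true) <|
  seq (loop 2 fun b => seq (push 3 b) (case d skip fun b => push 4 b)) <|
  seq (clear d) <| seq (move 3 2) (move 4 d)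

/-- For each unit of the cap at most one unit passes from `d` to stack 4, which thus collects the
minimum. The excess on `d` is discarded, and the cap is poured back from stack 3. -/
theorem runsIn_inc {d B x : ℕ} (hd : 5 ≤ d) (s : Store) (h2 : s 2 = U B) (h3 : s 3 = [])
    (h4 : s 4 = []) (hs : s d = U x) :
    RunsIn (inc d) s (update s d (U (min B (x + 1)))) (10 * B + 2 * x + 20) := by
  have d2 : d ≠ 2 := by omega
  have d3 : d ≠ 3 := by omega
  have d4 : d ≠ 4 := by omega
  let S : ℕ → Store := fun i => update (update (update (update s 2 (U (B - i))) 3 (U i))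
    d (U (x + 1 - i))) 4 (U (min i (x + 1)))
  have e0 : update s d (true :: s d) = S 0 := by
    funext y
    simp only [S, update_apply]
    split_ifs <;> simp_all [List.replicate_succ]
  have hl : RunsIn (loop 2 fun b => seq (push 3 b) (case d skip fun b => push 4 b))
      (S 0) (S B) (B * (1 + 2 + 1) + 1) := by
    refine runsIn_loop_unary B S (fun i hi => by simp [S, d2.symm]) (fun i hi => ?_)
    refine (runsIn_push _ _ _).seq ?_
    rcases Nat.lt_or_ge i (x + 1) with hx | hx
    · obtain ⟨z, hz⟩ : ∃ z, x + 1 - i = z + 1 := ⟨x - i, by omega⟩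
      refine RunsIn.case_cons (b := true) (l := U z) ?_ ((runsIn_push _ 4 true).congr ?_ le_rfl)
      · simp [S, d2, d3, d4, hz, List.replicate_succ]
      · funext y
        simp only [S, update_apply, show x + 1 - (i + 1) = z by omega,
          show min (i + 1) (x + 1) = i + 1 by omega, show min i (x + 1) = i by omega,
          Nat.sub_sub]
        clear hs h2 h3 h4
        split_ifs <;> first | rfl | omega
    · refine RunsIn.case_nil ?_ ((runsIn_skip _).congr ?_ le_rfl)
      · simp [S, d2, d3, d4, show x + 1 - i = 0 by omega]
      · funext y
        simp only [S, update_apply, show x + 1 - (i + 1) = 0 by omega,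
          show min (i + 1) (x + 1) = x + 1 by omega, show min i (x + 1) = x + 1 by omega,
          show x + 1 - i = 0 by omega, Nat.sub_sub]
        split_ifs <;> first | rfl | omega
  have h5 := (runsIn_push s d true).seq <| RunsIn.seq (e0 ▸ hl) <|
    (runsIn_clear d (U (x + 1 - B)) (S B) (by simp [S, d4])).seq <|
    (runsIn_move (k := 3) (j := 2) (by decide) (U B) _ (by simp [S, d3.symm])).seq <|
    (runsIn_move (k := 4) (j := d) d4.symm (U (min B (x + 1))) _ (by simp [S, d4.symm]))
  refine h5.congr ?_ (by simp; omega)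
  funext y
  simp only [S, update_apply]
  split_ifs <;> simp_all

end Cmd

/-! ### Expressions with bounded values -/

/-- Put `x` in front of the environment `v`. -/
def envCons (x : ℕ) (v : ℕ → ℕ) : ℕ → ℕ
  | 0 => x
  | i + 1 => v i

@[simp] theorem envCons_zero (x : ℕ) (v : ℕ → ℕ) : envCons x v 0 = x := rfl

@[simp] theorem envCons_succ (x : ℕ) (v : ℕ → ℕ) (i : ℕ) : envCons x v (i + 1) = v i := rfl

@[simp] theorem envCons_one (x : ℕ) (v : ℕ → ℕ) : envCons x v 1 = v 0 := rfl

/-- Expressions with de Bruijn variables, evaluated relative to a word and to a bound on all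
values. -/
inductive Expr : Type
  | var (i : ℕ)
  | zero
  | succ (e : Expr)
  /-- the bit of the word at a position -/
  | bit (e : Expr)
  | ren (ρ : ℕ → ℕ) (e : Expr)
  | lett (e f : Expr)
  /-- primitive recursion; the step `f` gets the index and the accumulator as variables `0`, `1` -/
  | prec (n b f : Expr)

namespace Expr

open Function Cmd

/-- The value of an expression; no value exceeds `B` unless a variable does. -/
def eval (B : ℕ) (w : List Bool) : Expr → (ℕ → ℕ) → ℕ
  | var i, v => v i
  | zero, _ => 0
  | succ e, v => min B (eval B w e v + 1)
  | bit e, v => (w.getD (eval B w e v) false).toNat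
  | ren ρ e, v => eval B w e fun i => v (ρ i)
  | lett e f, v => eval B w f (envCons (eval B w e v) v)
  | prec n b f, v => Nat.rec (eval B w b v)
      (fun i acc => eval B w f (envCons i (envCons acc v))) (eval B w n v)

theorem envCons_le {B x : ℕ} {v : ℕ → ℕ} (hx : x ≤ B) (hv : ∀ i, v i ≤ B) :
    ∀ i, envCons x v i ≤ B
  | 0 => hx
  | i + 1 => hv i

theorem eval_le {B : ℕ} {w : List Bool} (hB : 1 ≤ B) : ∀ (e : Expr) {v : ℕ → ℕ}, (∀ i, v i ≤ B) →
    eval B w e v ≤ B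
  | var i, _, hv => hv i
  | zero, _, _ => Nat.zero_le _
  | succ _, _, _ => min_le_left _ _
  | bit _, _, _ => (Bool.toNat_le _).trans hB
  | ren ρ e, _, hv => eval_le hB e fun i => hv (ρ i)
  | lett e f, _, hv => eval_le hB f (envCons_le (eval_le hB e hv) hv)
  | prec n b f, v, hv => by
    have : ∀ m ≤ B, (Nat.rec (eval B w b v)
        (fun i acc => eval B w f (envCons i (envCons acc v))) m : ℕ) ≤ B := by
      intro m
      induction m with
      | zero => exact fun _ => eval_le hB b hv
      | succ m ih =>
        intro hm
        exact eval_le hB f (envCons_le (by omega) (envCons_le (ih (by omega)) hv))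
    exact this _ (eval_le hB n hv)

/-- The program computing an expression: variable `i` is on stack `ρ i`, the result goes to stack
`d`, and the stacks from `d` on are empty at the start. -/
def code : Expr → (ℕ → ℕ) → ℕ → Cmd
  | var i, ρ, d => copy (ρ i) d
  | zero, _, _ => .skip
  | succ e, ρ, d => .seq (code e ρ d) (inc d)
  | bit e, ρ, d => .seq (code e ρ d) <|
      .seq (.loop d fun _ => .case 1 .skip fun b => .push 3 b) <|
      .seq (.case 1 .skip fun b => .seq (.push 1 b) (cond b (.push d true) .skip)) (move 3 1)
  | ren ρ' e, ρ, d => code e (fun i => ρ (ρ' i)) d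
  | lett e f, ρ, d => .seq (code e ρ d) <| .seq (code f (envCons d ρ) (d + 1)) <|
      .seq (clear d) (move (d + 1) d)
  | prec n b f, ρ, d => .seq (code n ρ d) <| .seq (code b ρ (d + 1)) <|
      .seq (.loop d fun _ => .seq (code f (envCons (d + 2) (envCons (d + 1) ρ)) (d + 3)) <|
        .seq (clear (d + 1)) <| .seq (move (d + 3) (d + 1)) (.push (d + 2) true)) <|
      .seq (clear (d + 2)) (move (d + 1) d)

/-- The condition under which the code of an expression works. -/
structure Ready (B : ℕ) (w : List Bool) (ρ : ℕ → ℕ) (d : ℕ) (v : ℕ → ℕ) (s : Store) : Prop where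
  one_le : 1 ≤ B
  d_ge : 6 ≤ d
  ρ_ge : ∀ i, 5 ≤ ρ i
  ρ_lt : ∀ i, ρ i < d
  val : ∀ i, s (ρ i) = U (v i)
  le : ∀ i, v i ≤ B
  empty : ∀ j, d ≤ j → s j = []
  word : s 1 = w
  cap : s 2 = U B
  tmp : s 3 = []
  tmp' : s 4 = []

theorem Ready.cons {B : ℕ} {w : List Bool} {ρ : ℕ → ℕ} {d : ℕ} {v : ℕ → ℕ} {s : Store}
    (h : Ready B w ρ d v s) {x : ℕ} (hx : x ≤ B) :
    Ready B w (envCons d ρ) (d + 1) (envCons x v) (update s d (U x)) := by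
  have h6 := h.d_ge
  refine ⟨h.one_le, by omega, ?_, ?_, ?_, envCons_le hx h.le, ?_, ?_, ?_, ?_, ?_⟩
  · rintro (_ | i)
    · exact (by omega : 5 ≤ d)
    · exact h.ρ_ge i
  · rintro (_ | i)
    · exact (by omega : d < d + 1)
    · exact (h.ρ_lt i).trans (by omega)
  · rintro (_ | i)
    · simp
    · have := h.ρ_lt i
      simp [h.val i, this.ne]
  · intro j hj
    rw [update_of_ne (by omega), h.empty j (by omega)]
  · rw [update_of_ne (by omega), h.word]
  · rw [update_of_ne (by omega), h.cap]
  · rw [update_of_ne (by omega), h.tmp]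
  · rw [update_of_ne (by omega), h.tmp']

/-- Other stacks may hold anything below the first free one. -/
theorem Ready.skip {B : ℕ} {w : List Bool} {ρ : ℕ → ℕ} {d : ℕ} {v : ℕ → ℕ} {s : Store}
    (h : Ready B w ρ d v s) (l : List Bool) :
    Ready B w ρ (d + 1) v (update s d l) := by
  have h6 := h.d_ge
  refine ⟨h.one_le, by omega, h.ρ_ge, fun i => (h.ρ_lt i).trans (by omega), ?_, h.le, ?_, ?_, ?_, ?_, ?_⟩
  · intro i
    rw [update_of_ne (h.ρ_lt i).ne, h.val i]
  · intro j hj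
    rw [update_of_ne (by omega), h.empty j (by omega)]
  · rw [update_of_ne (by omega), h.word]
  · rw [update_of_ne (by omega), h.cap]
  · rw [update_of_ne (by omega), h.tmp]
  · rw [update_of_ne (by omega), h.tmp']

theorem Ready.ren {B : ℕ} {w : List Bool} {ρ : ℕ → ℕ} {d : ℕ} {v : ℕ → ℕ} {s : Store}
    (h : Ready B w ρ d v s) (ρ' : ℕ → ℕ) :
    Ready B w (fun i => ρ (ρ' i)) d (fun i => v (ρ' i)) s :=
  ⟨h.one_le, h.d_ge, fun _ => h.ρ_ge _, fun _ => h.ρ_lt _, fun _ => h.val _, fun _ => h.le _, h.empty,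
    h.word, h.cap, h.tmp, h.tmp'⟩

/-- The first `x` bits are poured onto stack 3, the next one is inspected, and all are poured back.
Past the end of the word nothing is popped or pushed, in agreement with the default `false` of
`getD`. -/
theorem runsIn_bit {B : ℕ} {w : List Bool} {d x : ℕ} {s : Store} (hd : 6 ≤ d) (hx : x ≤ B)
    (h0 : s d = U x) (h1 : s 1 = w) (h3 : s 3 = []) :
    RunsIn (.seq (.loop d fun _ => .case 1 .skip fun b => .push 3 b) <|
      .seq (.case 1 .skip fun b => .seq (.push 1 b) (cond b (.push d true) .skip)) (move 3 1)) s
      (update s d (U (w.getD x false).toNat)) (10 * B + 10) := by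
  have d1 : d ≠ 1 := by omega
  have d3 : d ≠ 3 := by omega
  let S : ℕ → Store := fun i => update (update (update s d (U (x - i))) 1 (w.drop i))
    3 (w.take i).reverse
  have e0 : s = S 0 := by
    funext y
    simp only [S, update_apply]
    split_ifs <;> simp_all
  have hl : RunsIn (.loop d fun _ => .case 1 .skip fun b => .push 3 b) s (S x)
      (x * (2 + 1) + 1) := by
    conv => arg 2; rw [e0]
    refine runsIn_loop_unary x S (fun i hi => by simp [S, d1, d3]) (fun i hi => ?_)
    rcases Nat.lt_or_ge i w.length with hw | hw
    · refine RunsIn.case_cons (b := w[i]) (l := w.drop (i + 1)) ?_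
        ((runsIn_push _ 3 w[i]).congr ?_ le_rfl)
      · simp [S, d1.symm]
      · have : (w.take (i + 1)).reverse = w[i] :: (w.take i).reverse := by
          rw [List.take_add_one, List.getElem?_eq_getElem hw]
          simp
        funext y
        simp only [S, update_apply, Nat.sub_sub, this]
        split_ifs <;> first | rfl | omega
    · refine RunsIn.case_nil ?_ ((runsIn_skip _).congr ?_ le_rfl)
      · simp [S, d1.symm, hw]
      · funext y
        simp only [S, update_apply, Nat.sub_sub, List.take_of_length_le hw,
          List.drop_of_length_le hw, List.take_of_length_le (show w.length ≤ i + 1 by omega),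
          List.drop_of_length_le (show w.length ≤ i + 1 by omega)]
        split_ifs <;> first | rfl | omega
  have hm : RunsIn (.case 1 .skip fun b => .seq (.push 1 b) (cond b (.push d true) .skip)) (S x)
      (update (S x) d (U (w.getD x false).toNat)) 3 := by
    have hSd : S x d = [] := by simp [S, d1, d3]
    rcases Nat.lt_or_ge x w.length with hw | hw
    · have hS1 : S x 1 = w[x] :: w.drop (x + 1) := by simp [S]
      have hb : w.getD x false = w[x] := by simp [hw]
      rw [hb]
      refine RunsIn.case_cons hS1 (RunsIn.seq (T := 1) (T' := 1) (runsIn_push _ 1 w[x]) ?_)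
      rw [update_idem, update_self, ← hS1, update_eq_self]
      cases w[x] with
      | false => exact (runsIn_skip _).congr (by simp [← hSd]) le_rfl
      | true => exact (runsIn_push _ _ _).congr (by simp [hSd]) le_rfl
    · refine RunsIn.case_nil ?_ ((runsIn_skip _).congr ?_ (by omega : 1 ≤ 2))
      · simp [S, hw]
      · rw [List.getD_eq_default _ _ hw]
        simp [← hSd]
  refine (hl.seq (hm.seq (runsIn_move (by decide) (w.take x).reverse _
    (by simp [S, d3.symm])))).congr ?_ ?_
  · funext y
    simp only [S, update_apply, List.reverse_reverse]
    split_ifs <;> first | rfl | omega | simp_all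
  · have := List.length_take_le x w
    simp only [List.length_reverse]
    omega

open Polynomial in
-- The polynomial depends on the expression alone and the time on `B`, not on the length of `w`.
-- This matters because the number k at the end of the input can be arbitrarily long compared with
-- n.
theorem runsIn_code (e : Expr) : ∃ P : ℕ[X], ∀ {B w ρ d v s}, Ready B w ρ d v s →
    RunsIn (code e ρ d) s (update s d (U (eval B w e v))) (P.eval B) := by
  induction e with
  | var i =>
    refine ⟨5 * X + 2, fun {B w ρ d v s} h => ?_⟩
    have h1 := h.d_ge
    have h2 := h.ρ_ge i
    have h3 := h.ρ_lt i
    refine (runsIn_copy (by omega) (by omega) h3.ne s h.tmp (h.empty d le_rfl)).congr ?_ ?_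
    · rw [h.val]
      rfl
    · have := h.le i
      simp [h.val]
      omega
  | zero =>
    refine ⟨1, fun {B w ρ d v s} h => (runsIn_skip s).congr ?_ (by simp)⟩
    rw [eval, U, List.replicate_zero, ← h.empty d le_rfl, update_eq_self]
  | succ e ih =>
    obtain ⟨P, hP⟩ := ih
    refine ⟨P + (12 * X + 20), fun {B w ρ d v s} h => ?_⟩
    have h1 := h.d_ge
    refine ((hP h).seq (runsIn_inc (B := B) (by omega) _ ?_ ?_ ?_ (update_self _ _ _))).congr ?_ ?_
    · rw [update_of_ne (by omega), h.cap]
    · rw [update_of_ne (by omega), h.tmp]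
    · rw [update_of_ne (by omega), h.tmp']
    · rw [update_idem]
      rfl
    · have := eval_le (w := w) h.one_le e h.le
      simp
      omega
  | bit e ih =>
    obtain ⟨P, hP⟩ := ih
    refine ⟨P + (10 * X + 10), fun {B w ρ d v s} h => ?_⟩
    have h1 := h.d_ge
    refine ((hP h).seq (runsIn_bit h1 (eval_le h.one_le e h.le) (update_self _ _ _)
      (w := w) ?_ ?_)).congr ?_ ?_
    · rw [update_of_ne (by omega), h.word]
    · rw [update_of_ne (by omega), h.tmp]
    · rw [update_idem]
      rfl
    · simp
  | ren ρ' e ih =>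
    obtain ⟨P, hP⟩ := ih
    exact ⟨P, fun {B w ρ d v s} h => hP (h.ren ρ')⟩
  | lett e f ihe ihf =>
    obtain ⟨P, hP⟩ := ihe
    obtain ⟨Q, hQ⟩ := ihf
    refine ⟨P + (Q + ((2 * X + 1) + (2 * X + 1))), fun {B w ρ d v s} h => ?_⟩
    have h1 := h.d_ge
    have hx := eval_le (w := w) h.one_le e h.le
    have hy := eval_le (w := w) h.one_le f (envCons_le hx h.le)
    refine ((hP h).seq ((hQ (h.cons hx)).seq ((runsIn_clear d (U (eval B w e v)) _ (by simp)).seq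
      (runsIn_move (by omega) (U (eval B w f (envCons (eval B w e v) v))) _
        (by simp))))).congr ?_ ?_
    · have h7 := h.empty (d + 1) (by omega)
      funext y
      simp only [update_apply, eval]
      split_ifs <;> first | omega | simp_all
    · simp
      omega
  | prec n b f ihn ihb ihf =>
    obtain ⟨P, hP⟩ := ihn
    obtain ⟨Q, hQ⟩ := ihb
    obtain ⟨R, hR⟩ := ihf
    refine ⟨P + (Q + (X * (R + (2 * X + 1 + (2 * X + 1 + 1)) + 1) + 1 + (2 * X + 1 + (2 * X + 1)))),
      fun {B w ρ d v s} h => ?_⟩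
    have h1 := h.d_ge
    set m := eval B w n v with hm
    have hmB : m ≤ B := eval_le h.one_le n h.le
    -- `F i` is the accumulator after `i` rounds. Stack `d` counts the remaining rounds, `d + 1`
    -- holds the accumulator, `d + 2` the index, and the body works from `d + 3` on.
    let F : ℕ → ℕ := fun i => Nat.rec (eval B w b v)
      (fun i acc => eval B w f (envCons i (envCons acc v))) i
    have hF : ∀ i ≤ B, F i ≤ B := by
      intro i
      induction i with
      | zero => exact fun _ => eval_le h.one_le b h.le
      | succ i ih =>
        intro hi
        exact eval_le h.one_le f (envCons_le (by omega) (envCons_le (ih (by omega)) h.le))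
    let S : ℕ → Store := fun i =>
      update (update (update s d (U (m - i))) (d + 1) (U (F i))) (d + 2) (U i)
    have hb : RunsIn (code b ρ (d + 1)) (update s d (U m)) (S 0) (Q.eval B) := by
      refine (hQ (h.skip (U m))).congr ?_ le_rfl
      have h7 := h.empty (d + 2) (by omega)
      funext y
      simp only [S, F, update_apply]
      split_ifs <;> first | omega | simp_all
    have hl : RunsIn (.loop d fun _ =>
        .seq (code f (envCons (d + 2) (envCons (d + 1) ρ)) (d + 3)) <|
        .seq (clear (d + 1)) <| .seq (move (d + 3) (d + 1)) (.push (d + 2) true))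
        (S 0) (S m) (m * (R.eval B + (2 * B + 1 + (2 * B + 1 + 1)) + 1) + 1) := by
      refine runsIn_loop_unary m S (fun i hi => by simp [S]) (fun i hi => ?_)
      have hFi := hF i (by omega)
      have hFi' := hF (i + 1) (by omega)
      have hr : Ready B w (envCons (d + 2) (envCons (d + 1) ρ)) (d + 3)
          (envCons i (envCons (F i) v)) (update (S i) d (U (m - i - 1))) := by
        have h9 := ((h.skip (U (m - i - 1))).cons hFi).cons (show i ≤ B by omega)
        have : update (S i) d (U (m - i - 1)) =
            update (update (update s d (U (m - i - 1))) (d + 1) (U (F i))) (d + 2) (U i) := by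
          funext y
          simp only [S, update_apply]
          split_ifs <;> first | omega | rfl
        rw [this]
        exact h9
      have h8 := (hR hr).seq ((runsIn_clear (d + 1) (U (F i)) _ (by simp [S])).seq
        ((runsIn_move (k := d + 3) (j := d + 1) (by omega) (U (F (i + 1))) _
          (by simp [S, F])).seq (runsIn_push _ (d + 2) true)))
      refine h8.congr ?_ ?_
      · have h7 := h.empty (d + 3) (by omega)
        funext y
        simp only [S, update_apply]
        split_ifs <;> first | omega | rfl | simp_all [Nat.sub_sub]
      · simp
        omega
    have hFm := hF m hmB
    refine ((hP h).seq (hb.seq (hl.seq ((runsIn_clear (d + 2) (U m) _ (by simp [S])).seq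
      (runsIn_move (k := d + 1) (j := d) (by omega) (U (F m)) _ (by simp [S])))))).congr ?_ ?_
    · have h7 := h.empty (d + 1) (by omega)
      have h8 := h.empty (d + 2) (by omega)
      funext y
      simp only [S, update_apply, eval]
      split_ifs <;> first | omega | simp_all [F]
    · simp
      have : m * (R.eval B + (2 * B + 1 + (2 * B + 1 + 1)) + 1) ≤
        B * (R.eval B + (2 * B + 1 + (2 * B + 1 + 1)) + 1) := Nat.mul_le_mul_right _ hmB
      omega

end Expr

/-! ### Generators of words -/

/-- Descriptions of words by loops over expressions. -/
inductive Gen : Type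
  /-- the bit `e` if `e` is `0` or `1`, nothing otherwise -/
  | emit (e : Expr)
  | seq (g h : Gen)
  /-- the concatenation over all values below `e` of the new variable -/
  | forr (e : Expr) (g : Gen)

namespace Gen

open Function Cmd Expr

/-- The word described. -/
def out (B : ℕ) (w : List Bool) : Gen → (ℕ → ℕ) → List Bool
  | emit e, v => match e.eval B w v with
    | 0 => [false]
    | 1 => [true]
    | _ => []
  | seq g h, v => out B w g v ++ out B w h v
  | forr e g, v => (List.range (e.eval B w v)).flatMap fun i => out B w g (envCons i v)

/-- The program that puts the word described on top of stack `0`. -/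
def code : Gen → (ℕ → ℕ) → ℕ → Cmd
  | emit e, ρ, d => .seq (e.code ρ d) <| .case d (.push 0 false) fun _ =>
      .case d (.push 0 true) fun _ => clear d
  | seq g h, ρ, d => .seq (code h ρ d) (code g ρ d)
  | forr e g, ρ, d => .seq (e.code ρ d) <| .loop d fun _ => code g (envCons d ρ) (d + 1)

theorem _root_.Expr.Ready.output {B : ℕ} {w : List Bool} {ρ : ℕ → ℕ} {d : ℕ} {v : ℕ → ℕ}
    {s : Store} (h : Ready B w ρ d v s) (l : List Bool) : Ready B w ρ d v (update s 0 l) := by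
  have h6 := h.d_ge
  refine ⟨h.one_le, h6, h.ρ_ge, h.ρ_lt, fun i => ?_, h.le, fun j hj => ?_, h.word, h.cap,
    h.tmp, h.tmp'⟩
  · have := h.ρ_ge i
    rw [update_of_ne (by omega), h.val i]
  · rw [update_of_ne (by omega), h.empty j hj]

open Polynomial in
-- This later bounds the bit size of the constructed instance, whose encoding is such a word.
theorem length_out_le (g : Gen) : ∃ P : ℕ[X], ∀ {B : ℕ} (w : List Bool) {v : ℕ → ℕ}, 1 ≤ B →
    (∀ i, v i ≤ B) → (g.out B w v).length ≤ P.eval B := by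
  induction g with
  | emit e =>
    refine ⟨1, fun w v _ _ => ?_⟩
    rw [out]
    split <;> simp
  | seq g h ihg ihh =>
    obtain ⟨P, hP⟩ := ihg
    obtain ⟨Q, hQ⟩ := ihh
    refine ⟨P + Q, fun w v hB hv => ?_⟩
    rw [out, List.length_append, eval_add]
    exact add_le_add (hP w hB hv) (hQ w hB hv)
  | forr e g ih =>
    obtain ⟨P, hP⟩ := ih
    refine ⟨X * P, fun {B} w v hB hv => ?_⟩
    have he := Expr.eval_le (w := w) hB e hv
    rw [out, List.length_flatMap, eval_mul, eval_X]
    refine (List.sum_le_card_nsmul _ (P.eval B) ?_).trans ?_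
    · intro x hx
      obtain ⟨i, hi, rfl⟩ := List.mem_map.1 hx
      have := List.mem_range.1 hi
      exact hP w hB (envCons_le (by omega) hv)
    · simpa using Nat.mul_le_mul_right _ he

open Polynomial in
-- Output is pushed on top of stack 0, so words are produced from their end. Accordingly `seq` runs
-- its second part first, and the descending loop counter itself serves as the loop variable.
theorem runsIn_code (g : Gen) : ∃ P : ℕ[X], ∀ {B w ρ d v s}, Ready B w ρ d v s →
    RunsIn (code g ρ d) s (update s 0 (g.out B w v ++ s 0)) (P.eval B) := by
  induction g with
  | emit e =>
    obtain ⟨P, hP⟩ := Expr.runsIn_code e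
    refine ⟨P + (2 * X + 3), fun {B w ρ d v s} h => ?_⟩
    have h1 := h.d_ge
    have h2 := h.empty d le_rfl
    have hx := Expr.eval_le (w := w) h.one_le e h.le
    rw [eval_add]
    refine (hP h).seq ?_
    rw [out]
    generalize e.eval B w v = x at hx
    match x with
    | 0 =>
      refine (RunsIn.case_nil (by simp) (runsIn_push _ 0 false)).congr ?_ (by simp)
      funext y
      simp only [update_apply]
      split_ifs <;> first | omega | simp_all
    | 1 =>
      refine (RunsIn.case_cons (b := true) (l := []) (by simp)
        (RunsIn.case_nil (by simp) (runsIn_push _ 0 true))).congr ?_ (by simp)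
      funext y
      simp only [update_apply]
      split_ifs <;> first | omega | simp_all
    | x + 2 =>
      refine (RunsIn.case_cons (b := true) (l := U (x + 1)) (by simp [List.replicate_succ])
        (RunsIn.case_cons (b := true) (l := U x) (by simp [List.replicate_succ])
        (runsIn_clear d (U x) _ (by simp)))).congr ?_ (by simp; omega)
      funext y
      simp only [update_apply]
      split_ifs <;> first | omega | simp_all
  | seq g h ihg ihh =>
    obtain ⟨P, hP⟩ := ihg
    obtain ⟨Q, hQ⟩ := ihh
    refine ⟨Q + P, fun {B w ρ d v s} h => ?_⟩
    refine ((hQ h).seq (hP (h.output _))).congr ?_ (by simp)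
    simp [out]
  | forr e g ih =>
    obtain ⟨P, hP⟩ := Expr.runsIn_code e
    obtain ⟨Q, hQ⟩ := ih
    refine ⟨P + (X * (Q + 1) + 1), fun {B w ρ d v s} h => ?_⟩
    have h1 := h.d_ge
    have h2 := h.empty d le_rfl
    set m := e.eval B w v with hm
    have hmB : m ≤ B := Expr.eval_le h.one_le e h.le
    let O : ℕ → List Bool := fun i => g.out B w (envCons i v)
    -- After `i` rounds the values `m - i, …, m - 1` have been treated.
    let S : ℕ → Store := fun i => update (update s d (U (m - i))) 0
      ((List.range' (m - i) i).flatMap O ++ s 0)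
    have hl : RunsIn (.loop d fun _ => code g (envCons d ρ) (d + 1)) (S 0) (S m)
        (m * (Q.eval B + 1) + 1) := by
      refine runsIn_loop_unary m S (fun i hi => ?_) (fun i hi => ?_)
      · simp [S, show d ≠ 0 by omega]
      · have hr := (h.cons (show m - i - 1 ≤ B by omega)).output
          ((List.range' (m - i) i).flatMap O ++ s 0)
        have he : update (S i) d (U (m - i - 1)) =
            update (update s d (U (m - i - 1))) 0 ((List.range' (m - i) i).flatMap O ++ s 0) := by
          funext y
          simp only [S, update_apply]
          split_ifs <;> first | omega | rfl
        rw [he]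
        refine (hQ hr).congr ?_ le_rfl
        have : (List.range' (m - (i + 1)) (i + 1)).flatMap O =
            O (m - i - 1) ++ (List.range' (m - i) i).flatMap O := by
          rw [List.range'_succ, List.flatMap_cons, show m - (i + 1) = m - i - 1 by omega,
            show m - i - 1 + 1 = m - i by omega]
        simp only [S, this, update_idem, update_self, List.append_assoc]
        rfl
    have h0 : S 0 = update s d (U m) := by
      funext y
      simp only [S, update_apply]
      split_ifs <;> first | omega | simp_all
    rw [h0] at hl
    refine ((hP h).seq hl).congr ?_ ?_
    · funext y
      simp only [S, update_apply, out, List.range_eq_range', ← hm, Nat.sub_self]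
      split_ifs <;> first | omega | simp_all [O]
    · simpa using hmB

end Gen

/-! ### Computing the cap from the input and printing a word -/

namespace Cmd

open Function

/-- Double the unary number on stack `2`. -/
def double : Cmd := seq (loop 2 fun _ => seq (push 3 true) (push 3 true)) (move 3 2)

theorem runsIn_double {s : Store} {x : ℕ} (h2 : s 2 = U x) (h3 : s 3 = []) :
    RunsIn double s (update s 2 (U (2 * x))) (7 * x + 2) := by
  let S : ℕ → Store := fun i => update (update s 2 (U (x - i))) 3 (U (2 * i))
  have h0 : s = S 0 := by
    funext y
    simp only [S, update_apply]
    split_ifs <;> simp_all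
  have hl : RunsIn (loop 2 fun _ => seq (push 3 true) (push 3 true)) s (S x)
      (x * (1 + 1 + 1) + 1) := by
    conv => arg 2; rw [h0]
    refine runsIn_loop_unary x S (fun i hi => by simp [S]) (fun i hi => ?_)
    refine ((runsIn_push _ _ _).seq (runsIn_push _ _ _)).congr ?_ le_rfl
    funext y
    simp only [S, update_apply, Nat.sub_sub]
    split_ifs <;> first | omega | rfl
  refine (hl.seq (runsIn_move (by decide) (U (2 * x)) _ (by simp [S]))).congr ?_ (by simp; omega)
  funext y
  simp only [S, update_apply]
  split_ifs <;> simp_all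

theorem runsIn_loop_double {s : Store} {k x n : ℕ} (hk : 4 ≤ k) (h2 : s 2 = U x) (h3 : s 3 = [])
    (hn : s k = U n) : RunsIn (loop k fun _ => double) s
      (update (update s k []) 2 (U (x * 2 ^ n))) (n * (7 * (x * 2 ^ n) + 3) + 1) := by
  let S : ℕ → Store := fun i => update (update s k (U (n - i))) 2 (U (x * 2 ^ i))
  have k2 : k ≠ 2 := by omega
  have k3 : k ≠ 3 := by omega
  have h0 : s = S 0 := by
    funext y
    simp only [S, update_apply]
    split_ifs <;> simp_all
  have hS : S n = update (update s k []) 2 (U (x * 2 ^ n)) := by simp [S]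
  rw [← hS]
  conv => arg 2; rw [h0]
  refine runsIn_loop_unary (T := 7 * (x * 2 ^ n) + 2) n S (fun i hi => by simp [S, k2])
    (fun i hi => ?_)
  have hp : 2 ^ i ≤ 2 ^ n := Nat.pow_le_pow_right (by norm_num) hi.le
  refine (runsIn_double (x := x * 2 ^ i) ?_ ?_).congr ?_ ?_
  · simp [S, k2.symm]
  · simp [S, k3.symm, h3]
  · funext y
    simp only [S, update_apply, Nat.sub_sub, pow_succ]
    split_ifs <;> first | omega | rfl | (congr 1; ring)
  · have := Nat.mul_le_mul_left x hp
    omega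

/-- Count on stack `6` the digits of the number whose self-delimiting code starts the input. -/
def countDigits : Cmd :=
  seq (push 7 true) <| seq (loop 7 fun _ => case 1 skip fun b => seq (push 3 b) <| cond b
    (seq (case 1 skip fun b' => push 3 b') (seq (push 6 true) (push 7 true))) skip) (move 3 1)

/-- Stack 7 is a flag, raised again after each pair of marker and digit but not after the delimiter.
The loop therefore stops in front of `rest`, whose length does not enter the time. -/
theorem runsIn_countDigits_aux (rest : List Bool) : ∀ (bits : List Bool) (s : Store),
    s 1 = bits.flatMap (fun b => [true, b]) ++ false :: rest → s 7 = [true] →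
    RunsIn (loop 7 fun _ => case 1 skip fun b => seq (push 3 b) <| cond b
      (seq (case 1 skip fun b' => push 3 b') (seq (push 6 true) (push 7 true))) skip) s
      (update (update (update (update s 7 []) 1 rest) 6 (U bits.length ++ s 6)) 3
        ((bits.flatMap (fun b => [true, b]) ++ [false]).reverse ++ s 3))
      (7 * bits.length + 5)
  | [], s, h1, h7 => by
    refine (RunsIn.loop_cons h7 (RunsIn.case_cons (b := false) (l := rest) ?_
      ((runsIn_push _ _ _).seq (runsIn_skip _))) (runsIn_loop_nil ?_)).congr ?_ (by simp)
    · simp [h1]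
    · simp
    · funext y
      rw [List.flatMap_nil, List.nil_append] at h1
      simp only [update_apply, List.flatMap_nil, List.length_nil, List.replicate_zero,
        List.nil_append, List.reverse_singleton, List.singleton_append]
      split_ifs <;> first | omega | rfl | (subst_vars; simp)
  | b :: bits, s, h1, h7 => by
    refine (RunsIn.loop_cons h7 (RunsIn.case_cons (b := true)
      (l := b :: bits.flatMap (fun b => [true, b]) ++ false :: rest) ?_
      ((runsIn_push _ _ _).seq ((RunsIn.case_cons (b := b)
      (l := bits.flatMap (fun b => [true, b]) ++ false :: rest) ?_ (runsIn_push _ _ _)).seq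
      ((runsIn_push _ _ _).seq (runsIn_push _ _ _)))))
      (runsIn_countDigits_aux rest bits _ ?_ ?_)).congr ?_ (by simp; omega)
    · simp [h1]
    · simp
    · simp
    · simp
    · funext y
      have : U (bits.length + 1) ++ s 6 = U bits.length ++ true :: s 6 := by
        rw [U, List.replicate_succ']
        simp
      simp only [update_apply, List.length_cons, this]
      clear this
      split_ifs <;> first | omega | rfl | simp

theorem runsIn_countDigits (n : ℕ) (rest : List Bool) (s : Store)
    (h1 : s 1 = encodeNumber n ++ rest) (h3 : s 3 = []) (h6 : s 6 = []) (h7 : s 7 = []) :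
    RunsIn countDigits s (update s 6 (U n.size)) (11 * n.size + 20) := by
  refine ((runsIn_push _ 7 true).seq ((runsIn_countDigits_aux rest n.bits _ ?_ ?_).seq
    (runsIn_move (by decide) (encodeNumber n).reverse _ ?_))).congr ?_ ?_
  · simp [h1, encodeNumber]
  · simp [h7]
  · simp [h3, encodeNumber]
  · funext y
    simp only [update_apply, Nat.size_eq_bits_len]
    split_ifs <;> simp_all
  · have h : (encodeNumber n).length = 2 * n.size + 1 := by
      simp [encodeNumber, Nat.size_eq_bits_len, List.length_flatMap, mul_comm]
    rw [List.length_reverse, h, Nat.size_eq_bits_len]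
    omega

open Polynomial in
theorem monotone_eval (P : ℕ[X]) : Monotone fun x : ℕ => P.eval x := by
  intro x y hxy
  simp only [Polynomial.eval_eq_sum, Polynomial.sum]
  exact Finset.sum_le_sum fun i _ => Nat.mul_le_mul_left _ (Nat.pow_le_pow_left hxy i)

/-- Multiply the number on stack `2` by two to the power of the number on stack `6`. -/
def scale : Cmd := seq (copy 6 7) (loop 7 fun _ => double)

theorem runsIn_scale {s : Store} {x a : ℕ} (h2 : s 2 = U x) (h3 : s 3 = []) (h6 : s 6 = U a)
    (h7 : s 7 = []) : RunsIn scale s (update s 2 (U (x * 2 ^ a)))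
      (5 * a + 2 + (a * (7 * (x * 2 ^ a) + 3) + 1)) := by
  refine ((runsIn_copy (k := 6) (j := 7) (by decide) (by decide) (by decide) s h3 h7).seq
    (runsIn_loop_double (n := a) (x := x) (by decide) ?_ ?_ ?_)).congr ?_ (by simp [h6])
  · simp [h2]
  · simp [h3]
  · simp [h6]
  · funext y
    simp only [update_apply]
    split_ifs <;> simp_all

/-- The environment in which the number of digits (plus four) is the only known value. -/
def env₀ (a : ℕ) : ℕ → ℕ := envCons a fun _ => 0

/-- The assignment of stacks to variables for `env₀`. -/
def reg₀ : ℕ → ℕ := envCons 6 fun _ => 5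

/-- From the input compute the bound `2 ^ q` and then the word described by `g`. -/
def generate (q : Expr) (g : Gen) : Cmd :=
  seq countDigits <| seq (push 6 true) <| seq (push 6 true) <| seq (push 6 true) <|
  seq (push 6 true) <| seq (push 2 true) <| seq scale <| seq scale <| seq scale <| seq scale <|
  seq (q.code reg₀ 7) <| seq (clear 2) <| seq (push 2 true) <| seq (loop 7 fun _ => double) <|
  g.code reg₀ 7

/-- All variables except the first share stack 5, which stays empty and thus represents zero. -/
theorem ready₀ {B : ℕ} {w : List Bool} {a : ℕ} (haB : a ≤ B) (hB : 1 ≤ B) :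
    Expr.Ready B w reg₀ 7 (env₀ a)
      (update (update (update (fun _ => []) 1 w) 6 (U a)) 2 (U B)) := by
  refine ⟨hB, by decide, ?_, ?_, ?_, ?_, ?_, ?_, ?_, ?_, ?_⟩
  · rintro (_ | i) <;> simp [reg₀]
  · rintro (_ | i) <;> simp [reg₀]
  · rintro (_ | i) <;> simp [reg₀, env₀]
  · rintro (_ | i) <;> simp [env₀, haB]
  · intro j hj
    rw [update_of_ne (by omega), update_of_ne (by omega), update_of_ne (by omega)]
  all_goals simp

open Polynomial in
-- The exponent `Q` is itself computed by an expression, under a preliminary cap `2 ^ (4 * a)`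
-- obtained from 1 by four scalings with `2 ^ a`, where `a = n.size + 4`. Only then is the cap `2 ^
-- Q` installed. The assumption `4 * a ≤ Q` makes the first stage polynomial in `2 ^ Q`.
theorem runsIn_generate (q : Expr) (g : Gen) : ∃ P : ℕ[X], ∀ (n : ℕ) (rest : List Bool) (Q : ℕ),
    q.eval (2 ^ (4 * (n.size + 4))) (encodeNumber n ++ rest) (env₀ (n.size + 4)) = Q →
    4 * (n.size + 4) ≤ Q → ∃ s', RunsIn (generate q g)
      (update (fun _ => []) 1 (encodeNumber n ++ rest)) s' (P.eval (2 ^ Q)) ∧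
      s' 0 = g.out (2 ^ Q) (encodeNumber n ++ rest) (env₀ (n.size + 4)) := by
  obtain ⟨P, hP⟩ := q.runsIn_code
  obtain ⟨R, hR⟩ := g.runsIn_code
  -- Each of the five doubling loops costs at most 7X² + 3X + 1 for X = 2^Q; the remaining terms are
  -- at most linear in X.
  refine ⟨P + R + 100 * X ^ 2 + 1000 * X, fun n rest Q hQ hn => ?_⟩
  set w := encodeNumber n ++ rest with hw
  set a := n.size + 4 with ha
  have haQ : a < 2 ^ Q := lt_of_le_of_lt (by omega) Q.lt_two_pow_self
  have ha4 : a < 2 ^ (4 * a) := lt_of_le_of_lt (by omega) (4 * a).lt_two_pow_self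
  have r1 := ready₀ (w := w) ha4.le (Nat.one_le_two_pow)
  have r2 := ready₀ (w := w) haQ.le (Nat.one_le_two_pow)
  let s₁ : Store := update (update (fun _ => []) 1 w) 6 (U n.size)
  let s₂ : Store := update (update (fun _ => []) 1 w) 6 (U a)
  have t1 : RunsIn countDigits (update (fun _ => []) 1 w) s₁ (11 * n.size + 20) :=
    runsIn_countDigits n rest _ (by simp [hw]) (by simp) (by simp) (by simp)
  refine ⟨_, (t1.seq ((runsIn_push _ _ _).seq <| (runsIn_push _ _ _).seq <|
    (runsIn_push _ _ _).seq <| (runsIn_push _ _ _).seq <| (RunsIn.congr (s'' := update s₂ 2 (U 1))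
      (runsIn_push _ 2 true) ?_ le_rfl).seq <|
    (runsIn_scale (x := 1) (a := a) ?_ ?_ ?_ ?_).seq <|
    (runsIn_scale (x := 1 * 2 ^ a) (a := a) ?_ ?_ ?_ ?_).seq <|
    (runsIn_scale (x := 1 * 2 ^ a * 2 ^ a) (a := a) ?_ ?_ ?_ ?_).seq <|
    ((runsIn_scale (x := 1 * 2 ^ a * 2 ^ a * 2 ^ a) (a := a) ?_ ?_ ?_ ?_).congr ?_ le_rfl).seq <|
    (hP r1).seq <|
    (runsIn_clear 2 (U (2 ^ (4 * a))) _ ?_).seq <| (runsIn_push _ _ _).seq <|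
    ((runsIn_loop_double (k := 7) (n := Q) (x := 1) (by decide) ?_ ?_ ?_).congr ?_ le_rfl).seq <|
    hR r2)).mono ?_, ?_⟩
  · funext y
    simp only [s₁, s₂, update_apply]
    split_ifs <;> first | omega | rfl
  iterate 16 simp [s₂]
  · have : 1 * 2 ^ a * 2 ^ a * 2 ^ a * 2 ^ a = 2 ^ (4 * a) := by ring
    rw [this]
    simp [s₂]
  · simp
  · simp
  · simp
  · simp [hQ]
  · funext y
    simp only [update_apply]
    split_ifs <;> simp_all
  · have h2 : 1 * 2 ^ a * 2 ^ a * 2 ^ a * 2 ^ a = 2 ^ (4 * a) := by ring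
    have h1 : 2 ^ (4 * a) ≤ 2 ^ Q := Nat.pow_le_pow_right (by norm_num) hn
    have h3 : ∀ z ≤ 2 ^ Q, ∀ b ≤ 2 ^ Q, b * (7 * z + 3) ≤ 7 * (2 ^ Q) ^ 2 + 3 * 2 ^ Q := by
      intro z hz b hb
      nlinarith [Nat.mul_le_mul hb hz]
    have hp : 1 * 2 ^ a * 2 ^ a * 2 ^ a ≤ 2 ^ Q ∧ 1 * 2 ^ a * 2 ^ a ≤ 2 ^ Q ∧ 1 * 2 ^ a ≤ 2 ^ Q := by
      simp only [one_mul, ← pow_add]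
      refine ⟨?_, ?_, ?_⟩ <;> exact Nat.pow_le_pow_right (by norm_num) (by omega)
    have e1 := h3 _ (h2.trans_le h1) _ haQ.le
    have e2 := h3 _ hp.1 _ haQ.le
    have e3 := h3 _ hp.2.1 _ haQ.le
    have e4 := h3 _ hp.2.2 _ haQ.le
    have e5 := h3 (1 * 2 ^ Q) (by omega) _ Q.lt_two_pow_self.le
    have e6 := monotone_eval P h1
    simp only [List.length_replicate, eval_add, eval_mul, eval_pow, eval_X, eval_ofNat] at e6 ⊢
    omega
  · simp

end Cmd

/-! ### From Dominating Set to Generalized T-Coloring -/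

namespace Red

open Finset

/-- Digit `t` of `x` in base `β`. -/
def dig (β x t : ℕ) : ℕ := x / β ^ t % β

theorem exists_dig {β : ℕ} (hβ : 1 ≤ β) (m : ℕ) (f : ℕ → ℕ) (hf : ∀ t, f t < β) :
    ∃ x < β ^ m, ∀ t < m, dig β x t = f t := by
  induction m generalizing f with
  | zero => exact ⟨0, by simp, by simp⟩
  | succ m ih =>
    obtain ⟨x, hx, h⟩ := ih (fun t => f (t + 1)) fun t => hf _
    refine ⟨f 0 + β * x, ?_, ?_⟩
    · have := hf 0
      rw [pow_succ]
      nlinarith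
    · rintro (_ | t) ht
      · simp [dig, Nat.mod_eq_of_lt (hf 0)]
      · have h1 : (f 0 + β * x) / β = x := by
          rw [Nat.add_mul_div_left _ _ hβ, Nat.div_eq_of_lt (hf 0), zero_add]
        rw [dig, pow_succ', ← Nat.div_div_eq_div_mul, h1]
        exact h t (by omega)

theorem sum_range_mul (f : ℕ → ℕ) (p m : ℕ) :
    ∑ x ∈ range (p * m), f x = ∑ i ∈ range p, ∑ t ∈ range m, f (i * m + t) := by
  induction p with
  | zero => simp
  | succ p ih => rw [add_mul, one_mul, sum_range_add, ih, sum_range_succ]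

/-- The relation between the value `a` of the `i`-th left variable (a subset of the `i`-th part of
the vertices) and the value `b` of the `j`-th right variable (for `j < p`, it says for each vertex
of the `j`-th part in which part to look for a dominating vertex; for `j = p`, it says for each
part how many of its vertices may be taken). -/
def Rel (n p m N k : ℕ) (adj : ℕ → ℕ → Prop) (i j a b : ℕ) : Prop :=
  (j < p → ∀ t < m, dig p b t = i → j * m + t < n → ∃ t' < m, dig 2 a t' ≠ 0 ∧
    i * m + t' < n ∧ (i * m + t' = j * m + t ∨ adj (i * m + t') (j * m + t))) ∧
  (j = p → ∑ t ∈ range m, dig 2 a t ≤ dig N b i ∧ ∑ i' ∈ range p, dig N b i' ≤ k)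

/-- The vertices `u < p` are the left variables, `p ≤ v ≤ 2p` the right variables, and `2p + 1` is
a reference point. The distance of two variables with values `a`, `b` is `2 ^ (m + 1) * b ± a`. -/
def Forb (n p m N k : ℕ) (adj : ℕ → ℕ → Prop) (u v d : ℕ) : Prop :=
  (v = 2 * p + 1 ∧ u < p ∧ 2 ^ m ≤ d) ∨
  (v = 2 * p + 1 ∧ p ≤ u ∧ u ≤ 2 * p ∧ d % (2 * 2 ^ m) ≠ 0) ∨
  (u < p ∧ p ≤ v ∧ v ≤ 2 * p ∧
    ¬ Rel n p m N k adj u (v - p)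
      ((d - 2 * 2 ^ m * ((d + 2 ^ m) / (2 * 2 ^ m))) + (2 * 2 ^ m * ((d + 2 ^ m) / (2 * 2 ^ m)) - d))
      ((d + 2 ^ m) / (2 * 2 ^ m)))

open Classical in
/-- The instance of Generalized T-Coloring. -/
noncomputable def inst (n p m N k : ℕ) (adj : ℕ → ℕ → Prop) (s : ℕ) : GTCInstance where
  n := 2 * p + 2
  G := ⊤
  t e := (range s).filter fun d => ∃ u v : Fin (2 * p + 2), (e : Sym2 (Fin (2 * p + 2))) = s(u, v) ∧
    Forb n p m N k adj u v d
  s := s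

/-- Since α < M, rounding `d` to the nearest multiple of 2M recovers `b`. One of the two truncated
differences vanishes and the other is α, so the sign is not needed. -/
theorem decode {M b α d : ℕ} (hα : α < M) (h : d = 2 * M * b + α ∨ 2 * M * b = d + α) :
    (d + M) / (2 * M) = b ∧ (d - 2 * M * b) + (2 * M * b - d) = α := by
  refine ⟨?_, by omega⟩
  have h1 : b * (2 * M) = 2 * M * b := by ring
  have h2 : (b + 1) * (2 * M) = 2 * M * b + 2 * M := by ring
  exact Nat.div_eq_of_lt_le (by omega) (by omega)

/-! ### Correctness of the reduction -/

section

variable {n p m N k : ℕ} {adj : ℕ → ℕ → Prop} {s : ℕ}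

theorem mem_t {u v : Fin (2 * p + 2)} (h : (inst n p m N k adj s).G.Adj u v) (d : ℕ) :
    d ∈ (inst n p m N k adj s).t ⟨s(u, v), h⟩ ↔
      d < s ∧ (Forb n p m N k adj u v d ∨ Forb n p m N k adj v u d) := by
  simp only [inst, mem_filter, mem_range]
  refine and_congr_right fun _ => ⟨?_, ?_⟩
  · rintro ⟨u', v', h1, h2⟩
    rcases Sym2.eq_iff.1 h1 with ⟨rfl, rfl⟩ | ⟨rfl, rfl⟩
    · exact Or.inl h2
    · exact Or.inr h2
  · rintro (h2 | h2)
    · exact ⟨u, v, rfl, h2⟩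
    · exact ⟨v, u, Sym2.eq_swap, h2⟩

/-- Every distance from `2 ^ m` up to `s - 1` is forbidden between a left vertex and the reference
vertex. The parameter ℓ is thus known exactly. -/
theorem bound_inst (hp : 1 ≤ p) (hs : 2 ^ m < s) : (inst n p m N k adj s).bound = s - 1 := by
  refine IsGreatest.csSup_eq ⟨?_, ?_⟩
  · have h : (inst n p m N k adj s).G.Adj (⟨0, by omega⟩ : Fin (2 * p + 2))
        (⟨2 * p + 1, by omega⟩ : Fin (2 * p + 2)) := by
      simp [inst]
    refine ⟨⟨_, h⟩, (mem_t h _).2 ⟨Nat.sub_lt (Nat.zero_lt_of_lt hs) one_pos,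
      Or.inl (Or.inl ⟨rfl, hp, ?_⟩)⟩⟩
    exact Nat.le_sub_one_of_lt hs
  · rintro d ⟨e, he⟩
    have h : d < s := by
      classical exact mem_range.1 (mem_filter.1 he).1
    omega

/-- The values of the variables are read off as distances to the reference vertex. A coloring may
put vertices on either side of it, so only absolute values are available, and these suffice by
`decode`. -/
theorem dominating_of_isProper (hn : n ≤ p * m) {c : Fin (2 * p + 2) → ℕ}
    (hc : (inst n p m N k adj s).IsProper c) :
    ∃ D : Finset (Fin n), D.card ≤ k ∧ ∀ v, v ∈ D ∨ ∃ u ∈ D, adj u v := by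
  have hforb : ∀ u v : Fin (2 * p + 2), u ≠ v →
      ¬ Forb n p m N k adj u v ((c u : ℤ) - (c v : ℤ)).natAbs := by
    intro u v huv hF
    have h1 : (inst n p m N k adj s).G.Adj u v := by simpa [inst] using huv
    -- The forbidden sets are cut off at `s`, but two colors in {1, …, s} always differ by less than
    -- `s`.
    refine hc.2 u v h1 ((mem_t h1 _).2 ⟨?_, Or.inl hF⟩)
    have h2 := hc.1 u
    have h3 := hc.1 v
    simp only [inst] at h2 h3
    omega
  let z : Fin (2 * p + 2) := ⟨2 * p + 1, by omega⟩
  let x : ℕ → ℤ := fun i => if h : i < 2 * p + 2 then (c ⟨i, h⟩ : ℤ) - c z else 0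
  let a : ℕ → ℕ := fun i => (x i).natAbs
  have ha : ∀ i < p, a i < 2 ^ m := by
    intro i hi
    have hi' : i < 2 * p + 2 := by omega
    have h := hforb ⟨i, hi'⟩ z (by simp [z, Fin.ext_iff]; omega)
    simp only [Forb, not_or] at h
    have h := h.1
    simp only [z, true_and, not_and, not_le] at h
    simpa [a, x, hi', z] using h hi
  have hb : ∀ j ≤ p, ∃ b, (x (p + j)).natAbs = 2 * 2 ^ m * b := by
    intro j hj
    have hj' : p + j < 2 * p + 2 := by omega
    have h := hforb ⟨p + j, hj'⟩ z (by simp [z, Fin.ext_iff]; omega)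
    simp only [Forb, not_or] at h
    have h := h.2.1
    simp only [z, true_and, not_and, ne_eq, not_not] at h
    have h := h (by omega) (by omega)
    obtain ⟨b, hb⟩ := Nat.dvd_of_mod_eq_zero h
    exact ⟨b, by simpa [x, hj', z] using hb⟩
  choose! b hb using hb
  have hrel : ∀ i < p, ∀ j ≤ p, Rel n p m N k adj i j (a i) (b j) := by
    intro i hi j hj
    have hi' : i < 2 * p + 2 := by omega
    have hj' : p + j < 2 * p + 2 := by omega
    have h := hforb ⟨i, hi'⟩ ⟨p + j, hj'⟩ (by simp [Fin.ext_iff]; omega)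
    simp only [Forb, not_or] at h
    have h := h.2.2
    simp only [not_and, not_not, Nat.add_sub_cancel_left] at h
    have h := h hi (by omega) (by omega)
    have h1 := ha i hi
    have h2 := hb j hj
    have hd := decode (M := 2 ^ m) (b := b j) (α := a i)
      (d := ((c ⟨i, hi'⟩ : ℤ) - (c ⟨p + j, hj'⟩ : ℤ)).natAbs) h1 (by
        -- The scaled right value is zero or exceeds `a i`, so the distance is one of `2 * 2 ^ m * b
        -- j ± a i`.
        have h3 : 2 * 2 ^ m * b j = 0 ∨ 2 * 2 ^ m ≤ 2 * 2 ^ m * b j := by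
          rcases Nat.eq_zero_or_pos (b j) with h0 | h0
          · simp [h0]
          · exact Or.inr (Nat.le_mul_of_pos_right _ h0)
        simp only [x, a, hi', hj', dif_pos] at h1 h2 ⊢
        omega)
    rwa [hd.1, hd.2] at h
  have hdiv : ∀ i t, t < m → (i * m + t) / m = i ∧ (i * m + t) % m = t := by
    intro i t ht
    rw [mul_comm, Nat.mul_add_div (by omega), Nat.mul_add_mod, Nat.div_eq_of_lt ht,
      Nat.mod_eq_of_lt ht]
    simp
  let sel : ℕ → ℕ := fun y => dig 2 (a (y / m)) (y % m)
  refine ⟨univ.filter fun y : Fin n => sel y ≠ 0, ?_, ?_⟩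
  · have h1 : (univ.filter fun y : Fin n => sel y ≠ 0).card ≤ ∑ y : Fin n, sel y := by
      rw [card_filter]
      refine sum_le_sum fun y _ => ?_
      split_ifs <;> omega
    have h2 : ∑ y : Fin n, sel y ≤ ∑ y ∈ range (p * m), sel y := by
      rw [Fin.sum_univ_eq_sum_range]
      exact sum_le_sum_of_subset (range_mono hn)
    rw [sum_range_mul] at h2
    have h3 : ∑ i ∈ range p, ∑ t ∈ range m, sel (i * m + t) ≤ ∑ i ∈ range p, dig N (b p) i := by
      refine sum_le_sum fun i hi => ?_
      have h4 := ((hrel i (mem_range.1 hi) p le_rfl).2 rfl).1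
      refine le_trans (le_of_eq (sum_congr rfl fun t ht => ?_)) h4
      simp only [sel, hdiv i t (mem_range.1 ht)]
    -- The bound on the total of the quotas is attached to the pairs with a left variable, so one
    -- left variable must exist; otherwise there are no vertices at all.
    rcases Nat.eq_zero_or_pos p with hp | hp
    · subst hp
      simp at hn
      subst hn
      simp
    · have h5 := ((hrel 0 hp p le_rfl).2 rfl).2
      omega
  · intro v
    have hm : 0 < m := by
      rcases Nat.eq_zero_or_pos m with rfl | h
      · have := v.2
        omega
      · exact h
    have hv : (v : ℕ) / m * m + v % m = v := by
      rw [mul_comm]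
      exact Nat.div_add_mod _ _
    have hj : (v : ℕ) / m < p := Nat.div_lt_of_lt_mul (by rw [mul_comm]; exact v.2.trans_le hn)
    have ht : (v : ℕ) % m < m := Nat.mod_lt _ hm
    have hi : dig p (b (v / m)) (v % m) < p := Nat.mod_lt _ (Nat.zero_lt_of_lt hj)
    obtain ⟨t', ht', h1, h2, h3⟩ := (hrel _ hi (v / m) hj.le).1 hj (v % m) ht rfl (by
      rw [hv]; exact v.2)
    rw [hv] at h3
    have h4 : sel (dig p (b (v / m)) (v % m) * m + t') ≠ 0 := by
      simpa only [sel, hdiv _ _ ht'] using h1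
    rcases h3 with h3 | h3
    · left
      rw [h3] at h4
      simpa using h4
    · exact Or.inr ⟨⟨_, h2⟩, by simpa using h4, h3⟩

/-- The reference vertex gets color 1 and all other values are laid out above it. Quotas are digits
in base `N` because `n < N`, and `p ≤ N` places the base-`p` words of length `m` below `N ^ m`; so
every right value is below `N ^ (m + p)`. -/
theorem exists_isProper (hn : n ≤ p * m) (hp : 1 ≤ p) (hnN : n < N) (hpN : p ≤ N)
    (hs : 2 * 2 ^ m * N ^ (m + p) ≤ s) {D : Finset (Fin n)} (hk : D.card ≤ k)
    (hD : ∀ v, v ∈ D ∨ ∃ u ∈ D, adj u v) : (inst n p m N k adj s).Positive := by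
  classical
  let f : ℕ → ℕ := fun y => if ∃ h : y < n, (⟨y, h⟩ : Fin n) ∈ D then 1 else 0
  have hf : ∑ i ∈ range p, ∑ t ∈ range m, f (i * m + t) = D.card := by
    rw [← sum_range_mul, ← sum_subset (range_mono hn), ← Fin.sum_univ_eq_sum_range, card_eq_sum_ones,
      ← sum_filter_add_sum_filter_not univ (fun y => y ∈ D)]
    · have : (univ.filter fun y => y ∉ D) ∩ D = ∅ := by
        ext y
        simp
      simp [f, this]
    · intro y _ hy
      simp only [mem_range] at hy
      simp [f, hy]
  choose a ha ha' using fun i => exists_dig (β := 2) (by norm_num) m (fun t => f (i * m + t))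
    (fun t => by simp only [f]; split_ifs <;> norm_num)
  have hdom : ∀ v : Fin n, ∃ u : Fin n, u ∈ D ∧ ((u : ℕ) = v ∨ adj u v) := by
    intro v
    rcases hD v with h | ⟨u, hu, h⟩
    · exact ⟨v, h, Or.inl rfl⟩
    · exact ⟨u, hu, Or.inr h⟩
  choose dom hdom using hdom
  have hdiv : ∀ y : Fin n, (y : ℕ) / m < p := fun y =>
    Nat.div_lt_of_lt_mul (by rw [mul_comm]; exact y.2.trans_le hn)
  -- Positions from `n` on only pad the parts; they get the digit 0, and `Rel` demands nothing
  -- there.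
  choose Y hY hY' using fun j => exists_dig hp m
    (fun t => if h : j * m + t < n then (dom ⟨_, h⟩ : ℕ) / m else 0)
    (fun t => by
      split_ifs
      · exact hdiv _
      · exact hp)
  have hle : ∀ i, i < p → ∑ t ∈ range m, f (i * m + t) ≤ n := by
    intro i hi
    refine le_trans (single_le_sum (f := fun i => ∑ t ∈ range m, f (i * m + t))
      (fun _ _ => Nat.zero_le _) (mem_range.2 hi)) ?_
    rw [hf]
    simpa using card_le_univ D
  obtain ⟨Z, hZ, hZ'⟩ := exists_dig (β := N) (by omega) p
    (fun i => if i < p then ∑ t ∈ range m, f (i * m + t) else 0) (fun i => by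
      split_ifs with h
      · exact (hle i h).trans_lt hnN
      · omega)
  let b : ℕ → ℕ := fun j => if j < p then Y j else Z
  have hN : 0 < N := by omega
  have hb : ∀ j, b j < N ^ (m + p) := by
    intro j
    simp only [b]
    split_ifs
    · exact (hY j).trans_le ((Nat.pow_le_pow_left hpN m).trans
        (Nat.pow_le_pow_right hN (by omega)))
    · exact hZ.trans_le (Nat.pow_le_pow_right hN (by omega))
  let c : Fin (2 * p + 2) → ℕ := fun v => if (v : ℕ) < p then 1 + a v else
    if (v : ℕ) ≤ 2 * p then 1 + 2 * 2 ^ m * b (v - p) else 1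
  have hM : 0 < 2 ^ m := by positivity
  have hNp : 0 < N ^ (m + p) := by positivity
  have hMs : 2 * 2 ^ m ≤ s := (Nat.le_mul_of_pos_right _ hNp).trans hs
  have hc : ∀ v, 1 ≤ c v ∧ c v ≤ s := by
    intro v
    simp only [c]
    split_ifs
    · have := ha v
      omega
    · have h1 := Nat.mul_le_mul_left (2 * 2 ^ m) (hb (v - p))
      rw [Nat.succ_eq_add_one, mul_add, mul_one] at h1
      omega
    · omega
  have hrel : ∀ i < p, ∀ j, Rel n p m N k adj i j (a i) (b j) := by
    intro i hi j
    refine ⟨fun hj t ht h1 h2 => ?_, ?_⟩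
    · simp only [b, hj, if_true, hY' j t ht, h2, dif_pos] at h1
      have hm : 0 < m := by omega
      have hdm := Nat.div_add_mod (dom ⟨_, h2⟩ : ℕ) m
      rw [h1, mul_comm] at hdm
      refine ⟨dom ⟨_, h2⟩ % m, Nat.mod_lt _ hm, ?_, ?_, ?_⟩
      · rw [ha' i _ (Nat.mod_lt _ hm)]
        simp [f, hdm, (hdom ⟨_, h2⟩).1]
      · rw [hdm]
        exact (dom _).2
      · rw [hdm]
        exact (hdom ⟨_, h2⟩).2
    · rintro rfl
      simp only [b, lt_irrefl, if_false]
      refine ⟨?_, ?_⟩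
      · rw [hZ' i hi, if_pos hi]
        exact le_of_eq (sum_congr rfl fun t ht => ha' i t (mem_range.1 ht))
      · refine le_trans (le_of_eq ?_) hk
        rw [← hf]
        refine sum_congr rfl fun i hi => ?_
        rw [hZ' i (mem_range.1 hi), if_pos (mem_range.1 hi)]
  have hforb : ∀ u v : Fin (2 * p + 2),
      ¬ Forb n p m N k adj u v ((c u : ℤ) - (c v : ℤ)).natAbs := by
    rintro u v (⟨hv, hu, h⟩ | ⟨hv, hu, hu', h⟩ | ⟨hu, hv, hv', h⟩)
    · have h1 := ha u
      simp only [c, hu, if_true, hv, show ¬ 2 * p + 1 < p by omega,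
        show ¬ 2 * p + 1 ≤ 2 * p by omega, if_false] at h
      omega
    · apply h
      have h1 : ((c u : ℤ) - (c v : ℤ)).natAbs = 2 * 2 ^ m * b (u - p) := by
        simp only [c, show ¬ (u : ℕ) < p by omega, hu', if_true, hv, show ¬ 2 * p + 1 < p by omega,
          show ¬ 2 * p + 1 ≤ 2 * p by omega, if_false]
        omega
      rw [h1, Nat.mul_mod_right]
    · apply h
      -- As in the converse direction, the product is zero or dominates the left value.
      have h3 : 2 * 2 ^ m * b (v - p) = 0 ∨ 2 * 2 ^ m ≤ 2 * 2 ^ m * b (v - p) := by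
        rcases Nat.eq_zero_or_pos (b (v - p)) with h0 | h0
        · simp [h0]
        · exact Or.inr (Nat.le_mul_of_pos_right _ h0)
      have h1 := ha u
      have hd := decode (M := 2 ^ m) (b := b (v - p)) (α := a u)
        (d := ((c u : ℤ) - (c v : ℤ)).natAbs) h1 (by
          simp only [c, show ¬ (v : ℕ) < p by omega, hv', if_true, hu, if_false]
          omega)
      rw [hd.1, hd.2]
      exact hrel u hu (v - p)
  refine ⟨c, hc, fun u v h hmem => ?_⟩
  rcases ((mem_t h _).1 hmem).2 with h1 | h1
  · exact hforb u v h1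
  · rw [← Int.natAbs_neg, neg_sub] at h1
    exact hforb v u h1

theorem positive_inst_iff (hn : n ≤ p * m) (hp : 1 ≤ p) (hnN : n < N) (hpN : p ≤ N)
    (hs : 2 * 2 ^ m * N ^ (m + p) ≤ s) : (inst n p m N k adj s).Positive ↔
      ∃ D : Finset (Fin n), D.card ≤ k ∧ ∀ v, v ∈ D ∨ ∃ u ∈ D, adj u v :=
  ⟨fun ⟨_, hc⟩ => dominating_of_isProper hn hc,
    fun ⟨_, hk, hD⟩ => exists_isProper hn hp hnN hpN hs hk hD⟩

end

end Red

namespace Expr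

/-! ### Derived expressions -/

/-- The number `k`. -/
def lit : ℕ → Expr
  | 0 => zero
  | k + 1 => succ (lit k)

/-- `e` under one more variable. -/
def up (e : Expr) : Expr := ren (fun i => i + 1) e

def add (e f : Expr) : Expr := prec e f (succ (var 1))

def mul (e f : Expr) : Expr := prec f zero (add (ren (fun i => i + 2) e) (var 1))

def pow (e f : Expr) : Expr := prec f (lit 1) (mul (ren (fun i => i + 2) e) (var 1))

/-- The inner recursion returns its last index, which is the predecessor of the accumulator. -/
def sub (e f : Expr) : Expr := prec f e (prec (var 1) zero (var 0))

def ite (c e f : Expr) : Expr := prec c f (ren (fun i => i + 2) e)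

/-- The sum of `e` over all values below `n` of the new variable. -/
def sum (n e : Expr) : Expr :=
  prec n zero (add (ren (fun i => if i = 0 then 0 else i + 1) e) (var 1))

def not (e : Expr) : Expr := sub (lit 1) e

def and (e f : Expr) : Expr := mul e f

def imp (e f : Expr) : Expr := not (and e (not f))

def or (e f : Expr) : Expr := imp (not e) f

def le (e f : Expr) : Expr := not (sub e f)

def lt (e f : Expr) : Expr := not (le f e)

def eq (e f : Expr) : Expr := and (le e f) (le f e)

def ex (n e : Expr) : Expr := sum n e

def all (n e : Expr) : Expr := not (ex n (not e))

/-- The quotient is the number of positive multiples of the divisor that do not exceed the dividend.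
-/
def div (e f : Expr) : Expr := sum e (le (mul (succ (var 0)) (up f)) (up e))

def mod (e f : Expr) : Expr := sub e (mul f (div e f))

def digit (β x t : Expr) : Expr := mod (div x (pow β t)) β

/-- `e` has the value `x`. -/
def V (B : ℕ) (w : List Bool) (v : ℕ → ℕ) (e : Expr) (x : ℕ) : Prop := e.eval B w v = x

/-- `e` is nonzero if and only if `P` holds. -/
def H (B : ℕ) (w : List Bool) (v : ℕ → ℕ) (e : Expr) (P : Prop) : Prop := e.eval B w v ≠ 0 ↔ P

section

variable {B : ℕ} {w : List Bool} {v : ℕ → ℕ} {e f c n : Expr} {x y z : ℕ} {P Q : Prop}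

theorem V.up (h : V B w v e x) : V B w (envCons z v) (up e) x := h

theorem V.lit {k : ℕ} (h : k ≤ B) : V B w v (lit k) k := by
  induction k with
  | zero => rfl
  | succ k ih =>
    have : eval B w (Expr.lit k) v = k := ih (by omega)
    rw [V, Expr.lit, eval, this, min_eq_right h]

theorem V.succ (h : V B w v e x) (hx : x + 1 ≤ B) : V B w v (succ e) (x + 1) := by
  rw [V, eval, show eval B w e v = x from h, min_eq_right hx]

theorem V.bit (h : V B w v e x) : V B w v (bit e) (w.getD x false).toNat := by
  rw [V, eval, show eval B w e v = x from h]

theorem H.lett (he : V B w v e x) (hf : H B w (envCons x v) f P) : H B w v (lett e f) P := by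
  rw [H, eval, show eval B w e v = x from he]
  exact hf

/-- The recursion starts from `f` itself, which is cut off only once a successor is taken; hence the
hypothesis on `f`. Saturated values are recorded exactly, since division and digits below tolerate
overflow. -/
theorem eval_add (e f : Expr) (v : ℕ → ℕ) (h : eval B w f v ≤ B) :
    eval B w (add e f) v = min B (eval B w e v + eval B w f v) := by
  rw [add, eval]
  generalize eval B w e v = m
  induction m with
  | zero => simpa using h
  | succ m ih =>
    simp only [eval] at ih ⊢
    rw [envCons_one, envCons_zero, ih]
    omega

theorem min_mul_min (B x y : ℕ) : min B (x * min B y) = min B (x * y) := by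
  rcases Nat.eq_zero_or_pos x with rfl | hx
  · simp
  rcases le_total y B with h | h
  · rw [min_eq_right h]
  · rw [min_eq_left h, min_eq_left (Nat.le_mul_of_pos_left _ hx),
      min_eq_left (h.trans (Nat.le_mul_of_pos_left _ hx))]

theorem eval_mul (e f : Expr) (v : ℕ → ℕ) :
    eval B w (mul e f) v = min B (eval B w e v * eval B w f v) := by
  rw [mul, eval]
  generalize eval B w f v = m
  induction m with
  | zero => simp [eval]
  | succ m ih =>
    simp only at ih ⊢
    have h1 : eval B w (ren (fun i => i + 2) e)
        (envCons m (envCons (min B (eval B w e v * m)) v)) = eval B w e v := rfl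
    have h2 : eval B w (var 1) (envCons m (envCons (min B (eval B w e v * m)) v)) =
      min B (eval B w e v * m) := rfl
    rw [ih, eval_add _ _ _ (by rw [h2]; exact min_le_left _ _), h1, h2, mul_add, mul_one]
    omega

theorem eval_pow (e f : Expr) (v : ℕ → ℕ) :
    eval B w (pow e f) v = min B (eval B w e v ^ eval B w f v) := by
  rw [pow, eval]
  generalize eval B w f v = m
  induction m with
  | zero => simp [eval, Expr.lit]
  | succ m ih =>
    simp only at ih ⊢
    have h1 : eval B w (ren (fun i => i + 2) e)
        (envCons m (envCons (min B (eval B w e v ^ m)) v)) = eval B w e v := rfl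
    have h2 : eval B w (var 1) (envCons m (envCons (min B (eval B w e v ^ m)) v)) =
      min B (eval B w e v ^ m) := rfl
    rw [ih, eval_mul, h1, h2, min_mul_min, pow_succ']

theorem V.add (he : V B w v e x) (hf : V B w v f y) (h : x + y ≤ B) :
    V B w v (add e f) (x + y) := by
  rw [V] at *
  rw [eval_add _ _ _ (by omega), he, hf, min_eq_right h]

theorem V.mul (he : V B w v e x) (hf : V B w v f y) (h : x * y ≤ B) :
    V B w v (mul e f) (x * y) := by
  rw [V] at *
  rw [eval_mul, he, hf, min_eq_right h]

theorem V.pow (he : V B w v e x) (hf : V B w v f y) (h : x ^ y ≤ B) :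
    V B w v (pow e f) (x ^ y) := by
  rw [V] at *
  rw [eval_pow, he, hf, min_eq_right h]

theorem V.sub (he : V B w v e x) (hf : V B w v f y) : V B w v (sub e f) (x - y) := by
  rw [V] at *
  rw [Expr.sub, eval, hf, he]
  induction y generalizing f with
  | zero => rfl
  | succ y ih =>
    have ih' : (Nat.rec x (fun i acc => eval B w (prec (var 1) zero (var 0))
      (envCons i (envCons acc v))) y : ℕ) = x - y := by
      clear hf ih
      induction y with
      | zero => rfl
      | succ y ih =>
        simp only at ih ⊢
        rw [ih, eval]
        simp only [eval, envCons_one, envCons_zero]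
        rw [← Nat.sub_sub]
        cases x - y <;> rfl
    simp only at ih' ⊢
    rw [ih', eval]
    simp only [eval, envCons_one, envCons_zero]
    rw [← Nat.sub_sub]
    cases x - y <;> rfl

theorem V.ite [Decidable P] (hc : H B w v c P) (he : P → V B w v e x) (hf : ¬ P → V B w v f y) :
    V B w v (ite c e f) (if P then x else y) := by
  rw [V, Expr.ite, eval]
  rw [H] at hc
  generalize eval B w c v = m at hc
  cases m with
  | zero =>
    have : ¬ P := fun h => hc.2 h rfl
    rw [if_neg this]
    exact hf this
  | succ m =>
    have : P := hc.1 (by omega)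
    rw [if_pos this]
    exact he this

theorem eval_sum (n e : Expr) (v : ℕ → ℕ) : eval B w (sum n e) v =
    min B (∑ i ∈ Finset.range (eval B w n v), eval B w e (envCons i v)) := by
  rw [sum, eval]
  generalize eval B w n v = m
  induction m with
  | zero => simp [eval]
  | succ m ih =>
    simp only at ih ⊢
    rw [ih]
    set S := ∑ i ∈ Finset.range m, eval B w e (envCons i v) with hS
    have h1 : eval B w (ren (fun i => if i = 0 then 0 else i + 1) e)
        (envCons m (envCons (min B S) v)) = eval B w e (envCons m v) := by
      rw [eval]
      congr 1
      funext i
      cases i <;> rfl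
    have h2 : eval B w (var 1) (envCons m (envCons (min B S) v)) = min B S := rfl
    rw [eval_add _ _ _ (by rw [h2]; exact min_le_left _ _), h1, h2, Finset.sum_range_succ, ← hS]
    omega

theorem V.sum {g : ℕ → ℕ} (hn : V B w v n x) (he : ∀ i < x, V B w (envCons i v) e (g i))
    (h : ∑ i ∈ Finset.range x, g i ≤ B) :
    V B w v (sum n e) (∑ i ∈ Finset.range x, g i) := by
  rw [V, eval_sum, show eval B w n v = x from hn,
    Finset.sum_congr rfl fun i hi => show eval B w e (envCons i v) = g i from
      he i (Finset.mem_range.1 hi), min_eq_right h]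

theorem H.of_V (h : V B w v e x) : H B w v e (x ≠ 0) := by
  rw [H, show eval B w e v = x from h]

theorem H.congr (h : H B w v e P) (hPQ : P ↔ Q) : H B w v e Q := Iff.trans h hPQ

theorem H.not (hB : 1 ≤ B) (h : H B w v e P) : H B w v (not e) (¬ P) := by
  have := V.sub (V.lit hB) (rfl : V B w v e _)
  refine (H.of_V this).congr ?_
  rw [H] at h
  rw [← h]
  omega

/-- The second factor needs a meaning only under `P`. This permits guards: a matrix entry, say, is
looked up only after a range check. -/
theorem H.and (hB : 1 ≤ B) (he : H B w v e P) (hf : P → H B w v f Q) :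
    H B w v (and e f) (P ∧ Q) := by
  rw [H, Expr.and, eval_mul]
  have : min B (eval B w e v * eval B w f v) ≠ 0 ↔ eval B w e v ≠ 0 ∧ eval B w f v ≠ 0 := by
    rw [← mul_ne_zero_iff]
    omega
  rw [this]
  constructor
  · rintro ⟨h1, h2⟩
    exact ⟨he.1 h1, (hf (he.1 h1)).1 h2⟩
  · rintro ⟨h1, h2⟩
    exact ⟨he.2 h1, (hf h1).2 h2⟩

theorem H.imp (hB : 1 ≤ B) (he : H B w v e P) (hf : P → H B w v f Q) :
    H B w v (imp e f) (P → Q) :=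
  ((he.and hB fun h => (hf h).not hB).not hB).congr (by tauto)

theorem H.or (hB : 1 ≤ B) (he : H B w v e P) (hf : ¬ P → H B w v f Q) :
    H B w v (or e f) (P ∨ Q) :=
  ((he.not hB).imp hB hf).congr (by tauto)

theorem H.le (hB : 1 ≤ B) (he : V B w v e x) (hf : V B w v f y) : H B w v (le e f) (x ≤ y) :=
  ((H.of_V (he.sub hf)).not hB).congr (by omega)

theorem H.lt (hB : 1 ≤ B) (he : V B w v e x) (hf : V B w v f y) : H B w v (lt e f) (x < y) :=
  ((H.le hB hf he).not hB).congr (by omega)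

theorem H.eq (hB : 1 ≤ B) (he : V B w v e x) (hf : V B w v f y) : H B w v (eq e f) (x = y) :=
  ((H.le hB he hf).and hB fun _ => H.le hB hf he).congr (by omega)

theorem H.ex (hB : 1 ≤ B) {R : ℕ → Prop} (hn : V B w v n x)
    (he : ∀ i < x, H B w (envCons i v) e (R i)) : H B w v (ex n e) (∃ i < x, R i) := by
  rw [H, Expr.ex, eval_sum, show eval B w n v = x from hn]
  have : min B (∑ i ∈ Finset.range x, eval B w e (envCons i v)) ≠ 0 ↔
      ∑ i ∈ Finset.range x, eval B w e (envCons i v) ≠ 0 := by omega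
  rw [this, Ne, Finset.sum_eq_zero_iff]
  push Not
  constructor
  · rintro ⟨i, hi, h⟩
    exact ⟨i, Finset.mem_range.1 hi, (he i (Finset.mem_range.1 hi)).1 h⟩
  · rintro ⟨i, hi, h⟩
    exact ⟨i, Finset.mem_range.2 hi, (he i hi).2 h⟩

theorem H.all (hB : 1 ≤ B) {R : ℕ → Prop} (hn : V B w v n x)
    (he : ∀ i < x, H B w (envCons i v) e (R i)) : H B w v (all n e) (∀ i < x, R i) :=
  ((H.ex hB hn fun i hi => (he i hi).not hB).not hB).congr (by push Not; rfl)

open Classical in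
theorem V.sgn (hB : 1 ≤ B) (h : H B w v e P) :
    V B w v (Expr.not (Expr.not e)) (if P then 1 else 0) := by
  have := V.sub (V.lit hB) (V.sub (V.lit hB) (rfl : V B w v e _))
  rw [V] at this ⊢
  rw [H] at h
  rw [Expr.not, Expr.not, this]
  split_ifs with hP
  · have := h.2 hP
    omega
  · have := mt h.1 hP
    omega

/-- The multiples of the divisor may be cut off at `B`, but since `x < B` their comparison with `x`
has the same outcome. -/
theorem eval_div (he : V B w v e x) (hx : x < B) (hy : 0 < eval B w f v) :
    V B w v (div e f) (x / eval B w f v) := by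
  set y := eval B w f v with hf
  have hB : 1 ≤ B := by omega
  have h1 : ∀ i < x, eval B w (Expr.le (Expr.mul (Expr.succ (var 0)) (Expr.up f)) (Expr.up e))
      (envCons i v) = if i < x / y then 1 else 0 := by
    intro i hi
    have h2 : V B w (envCons i v) (Expr.mul (Expr.succ (var 0)) (Expr.up f))
        (min B ((i + 1) * y)) := by
      rw [V, eval_mul, eval, eval, envCons_zero, min_eq_right (by omega : i + 1 ≤ B)]
      rfl
    have h3 : V B w (envCons i v) (Expr.le (Expr.mul (Expr.succ (var 0)) (Expr.up f)) (Expr.up e))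
        (1 - (min B ((i + 1) * y) - x)) :=
      V.sub (V.lit hB) (h2.sub (V.up he))
    rw [V] at h3
    rw [h3]
    have h4 : i < x / y ↔ (i + 1) * y ≤ x := by
      rw [← Nat.le_div_iff_mul_le hy]
      rfl
    split_ifs with h5
    · have := h4.1 h5
      omega
    · have := mt h4.2 h5
      omega
  have h2 : ∑ i ∈ Finset.range x, (if i < x / y then 1 else 0) = x / y := by
    rw [Finset.sum_boole]
    have : (Finset.range x).filter (fun i => i < x / y) = Finset.range (x / y) := by
      ext i
      have := Nat.div_le_self x y
      simp only [Finset.mem_filter, Finset.mem_range]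
      omega
    rw [this]
    simp
  rw [← h2]
  refine V.sum he h1 ?_
  rw [h2]
  exact (Nat.div_le_self _ _).trans hx.le

theorem V.div (he : V B w v e x) (hf : V B w v f y) (hx : x < B) (hy : 0 < y) :
    V B w v (div e f) (x / y) := by
  rw [V] at hf
  subst hf
  exact eval_div he hx hy

theorem V.mod (he : V B w v e x) (hf : V B w v f y) (hx : x < B) (hy : 0 < y) :
    V B w v (mod e f) (x % y) := by
  rw [Nat.mod_eq_sub_mul_div]
  exact he.sub (hf.mul (he.div hf hx hy) ((Nat.mul_div_le _ _).trans hx.le))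

/-- No bound on the power `y ^ z` is needed: if it is cut off at `B`, the true and the computed
quotient are both 0. -/
theorem V.digit (he : V B w v e x) (hf : V B w v f y) (hc : V B w v c z) (hx : x < B)
    (hy : 0 < y) : V B w v (digit f e c) (Red.dig y x z) := by
  have hB : 1 ≤ B := by omega
  have h1 : eval B w (Expr.pow f c) v = min B (y ^ z) := by
    rw [V] at *
    rw [eval_pow, hf, hc]
  have hyz : 0 < y ^ z := by positivity
  have h2 : V B w v (Expr.div e (Expr.pow f c)) (x / y ^ z) := by
    have := eval_div (f := Expr.pow f c) he hx (by rw [h1]; omega)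
    rw [h1] at this
    rcases le_total (y ^ z) B with h | h
    · rwa [min_eq_right h] at this
    · rw [min_eq_left h] at this
      rw [Nat.div_eq_of_lt (hx.trans_le h)]
      rwa [Nat.div_eq_of_lt hx] at this
  exact h2.mod hf ((Nat.div_le_self _ _).trans_lt hx) hy

end

end Expr

/-! ### Printing self-delimiting numbers -/

namespace Gen

open Expr

/-- The word described by `g`, under a further variable, if `e` is nonzero; nothing otherwise. -/
def when (e : Expr) (g : Gen) : Gen := forr (Expr.not (Expr.not e)) g

theorem out_when {B : ℕ} {w : List Bool} {v : ℕ → ℕ} {e : Expr} {P : Prop}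
    [inst : Decidable P] {g : Gen} {l : List Bool} (hB : 1 ≤ B) (h : H B w v e P)
    (hg : P → g.out B w (envCons 0 v) = l) :
    (when e g).out B w v = if P then l else [] := by
  have : eval B w (Expr.not (Expr.not e)) v = _ := V.sgn hB h
  rw [when, out, this]
  split_ifs with hP
  · simp [hg hP]
  · simp

/-- The self-delimiting code of `e`. -/
def number (e : Expr) : Gen :=
  seq (forr e (when (Expr.le (Expr.pow (lit 2) (var 0)) (Expr.up e))
    (seq (emit (lit 1)) (emit (digit (lit 2) (Expr.up (Expr.up e)) (var 1)))))) (emit zero)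

theorem flatMap_range_ite {α : Type*} {x y : ℕ} (hxy : y ≤ x) (f : ℕ → List α) :
    (List.range x).flatMap (fun i => if i < y then f i else []) = (List.range y).flatMap f := by
  obtain ⟨z, rfl⟩ := Nat.exists_eq_add_of_le hxy
  rw [List.range_add, List.flatMap_append, List.flatMap_map]
  have h1 : (List.range y).flatMap (fun i => if i < y then f i else []) =
      (List.range y).flatMap f :=
    List.flatMap_congr fun i hi => if_pos (List.mem_range.1 hi)
  have h2 : (List.range z).flatMap (fun i => if y + i < y then f (y + i) else []) = [] := by
    simp
  rw [h1, h2, List.append_nil]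

theorem bits_eq_map (n : ℕ) : n.bits = (List.range n.size).map fun i => n.testBit i := by
  refine List.ext_getElem (by simp [Nat.size_eq_bits_len]) fun i h1 h2 => ?_
  rw [List.getElem_map, List.getElem_range, Nat.testBit_eq_inth, List.getI_eq_getElem _ h1]

/-- The condition `2 ^ i ≤ x` says that `x` has more than `i` digits. Running over all `i < x` is
wasteful but still polynomial in `B`. -/
theorem out_number {B : ℕ} {w : List Bool} {v : ℕ → ℕ} {e : Expr} {x : ℕ} (hB : 2 ≤ B)
    (h : V B w v e x) (hx : x < B) : (number e).out B w v = encodeNumber x := by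
  classical
  have hB' : 1 ≤ B := by omega
  change (List.range (eval B w e v)).flatMap _ ++ [false] = _
  rw [show eval B w e v = x from h, encodeNumber, bits_eq_map, List.flatMap_map]
  congr 1
  rw [← flatMap_range_ite (Nat.size_le.2 x.lt_two_pow_self)]
  refine List.flatMap_congr fun i hi => ?_
  have hi := List.mem_range.1 hi
  refine (out_when (P := i < x.size) (l := [true, x.testBit i]) hB' ?_ fun hP => ?_).trans ?_
  · have h1 : V B w (envCons i v) (Expr.pow (lit 2) (var 0)) (min B (2 ^ i)) := by
      rw [V, eval_pow, show eval B w (lit 2) (envCons i v) = 2 from V.lit hB]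
      rfl
    refine (H.le hB' h1 (V.up h)).congr ?_
    rw [Nat.lt_size]
    omega
  · have h1 : eval B w (lit 1) (envCons 0 (envCons i v)) = 1 := V.lit hB'
    have h2 : eval B w _ (envCons 0 (envCons i v)) = Red.dig 2 x i :=
      V.digit (V.up (z := 0) (V.up (z := i) h)) (V.lit hB)
      (rfl : V B w (envCons 0 (envCons i v)) (var 1) i) hx (by norm_num)
    rw [out, out, h1, out, h2, Red.dig, Nat.testBit_eq_decide_div_mod_eq]
    rcases Nat.mod_two_eq_zero_or_one (x / 2 ^ i) with h3 | h3 <;> simp [h3]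
  · split_ifs <;> rfl

end Gen

/-! ### The input word of Dominating Set -/

theorem length_encodeNumber (n : ℕ) : (encodeNumber n).length = 2 * n.size + 1 := by
  simp [encodeNumber, Nat.size_eq_bits_len, List.length_flatMap, mul_comm]

theorem getD_flatMap_pairs (r : List Bool) : ∀ (l : List Bool) (i : ℕ), i < l.length →
    (l.flatMap (fun b => [true, b]) ++ r).getD (2 * i) false = true ∧
    (l.flatMap (fun b => [true, b]) ++ r).getD (2 * i + 1) false = l.getD i false
  | [], i, h => absurd h (by simp)
  | b :: l, 0, _ => by simp
  | b :: l, i + 1, h => by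
    have := getD_flatMap_pairs r l i (by simpa using h)
    simpa [mul_add, List.getD_cons_succ] using this

theorem getD_encodeNumber_append (n : ℕ) (r : List Bool) {i : ℕ} (hi : i < n.size) :
    (encodeNumber n ++ r).getD (2 * i) false = true ∧
    (encodeNumber n ++ r).getD (2 * i + 1) false = n.testBit i := by
  have := getD_flatMap_pairs ([false] ++ r) n.bits i (by rwa [Nat.size_eq_bits_len])
  rw [encodeNumber, List.append_assoc, this.1, this.2]
  refine ⟨rfl, ?_⟩
  simp [Gen.bits_eq_map, hi]

/-- The marker at position `2 * i`, with default `false` beyond the end, tells whether there are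
more than `i` digits. A single lookup thus detects a large number without reading it through. -/
theorem getD_encodeNumber (n i : ℕ) :
    (encodeNumber n).getD (2 * i) false = decide (i < n.size) ∧
    (encodeNumber n).getD (2 * i + 1) false = n.testBit i := by
  rcases Nat.lt_or_ge i n.size with hi | hi
  · have := getD_encodeNumber_append n [] hi
    rw [List.append_nil] at this
    rw [this.1, this.2]
    simp [hi]
  · have h1 : n.testBit i = false := Nat.testBit_lt_two_pow (Nat.size_le.1 hi)
    rw [h1, List.getD_eq_default (n := 2 * i + 1) _ _ (by rw [length_encodeNumber]; omega)]
    refine ⟨?_, rfl⟩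
    rcases hi.eq_or_lt with rfl | hi
    · rw [encodeNumber, List.getD_append_right _ _ _ _ (by
        simp [List.length_flatMap, Nat.size_eq_bits_len, mul_comm])]
      simp [List.length_flatMap, Nat.size_eq_bits_len, mul_comm]
    · rw [List.getD_eq_default _ _ (by rw [length_encodeNumber]; omega)]
      simp [hi.le]

theorem encodeMatrix_singleton (n : ℕ) (f : Fin n → Fin n → Bool) :
    encodeMatrix n (fun u v => [f u v]) =
      List.ofFn fun k : Fin (n * n) => f k.divNat k.modNat := by
  rw [encodeMatrix, List.ofFn_mul]
  simp only [List.flatMap_def, List.ofFn_eq_map]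
  congr 1
  refine List.map_congr_left fun u _ => ?_
  rw [← List.flatMap_def, ← List.map_eq_flatMap]
  refine List.map_congr_left fun v _ => ?_
  congr 1 <;> ext
  · simp only [Fin.coe_divNat]
    rw [mul_comm, Nat.mul_add_div v.pos, Nat.div_eq_of_lt v.2, add_zero]
  · simp only [Fin.coe_modNat]
    rw [mul_comm, Nat.mul_add_mod, Nat.mod_eq_of_lt v.2]

namespace DSInstance

/-- The adjacency of the graph as a relation on numbers. -/
def adj (x : DSInstance) (u v : ℕ) : Prop :=
  ∃ (hu : u < x.n) (hv : v < x.n), x.G.Adj ⟨u, hu⟩ ⟨v, hv⟩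

theorem encode_eq (x : DSInstance) : ∃ M : List Bool, M.length = x.n * x.n ∧
    x.encode = encodeNumber x.n ++ (M ++ encodeNumber x.k) ∧
    ∀ u v, u < x.n → v < x.n → (M.getD (u * x.n + v) false = true ↔ x.adj u v) := by
  classical
  refine ⟨encodeMatrix x.n fun u v => [decide (x.G.Adj u v)], ?_, ?_, ?_⟩
  · rw [encodeMatrix_singleton, List.length_ofFn]
  · rw [encode, List.append_assoc]
  · intro u v hu hv
    have hlt : u * x.n + v < x.n * x.n := by nlinarith
    rw [encodeMatrix_singleton, List.getD_eq_getElem _ _ (by simpa using hlt), List.getElem_ofFn]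
    have h1 : (⟨u * x.n + v, hlt⟩ : Fin (x.n * x.n)).divNat = ⟨u, hu⟩ := by
      ext
      simp only [Fin.coe_divNat]
      rw [mul_comm, Nat.mul_add_div (by omega), Nat.div_eq_of_lt hv, add_zero]
    have h2 : (⟨u * x.n + v, hlt⟩ : Fin (x.n * x.n)).modNat = ⟨v, hv⟩ := by
      ext
      simp only [Fin.coe_modNat]
      rw [mul_comm, Nat.mul_add_mod, Nat.mod_eq_of_lt hv]
    rw [h1, h2]
    simp [adj, hu, hv]

theorem encode_digit (x : DSInstance) {i : ℕ} (hi : i < x.n.size) :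
    x.encode.getD (2 * i + 1) false = x.n.testBit i := by
  obtain ⟨M, _, h, _⟩ := x.encode_eq
  rw [h]
  exact (getD_encodeNumber_append _ _ hi).2

theorem encode_adj (x : DSInstance) {u v : ℕ} (hu : u < x.n) (hv : v < x.n) :
    x.encode.getD (2 * x.n.size + 1 + (u * x.n + v)) false = true ↔ x.adj u v := by
  obtain ⟨M, hM, h, hadj⟩ := x.encode_eq
  have hlt : u * x.n + v < x.n * x.n := by nlinarith
  rw [h, List.getD_append_right _ _ _ _ (by rw [length_encodeNumber]; omega), length_encodeNumber,
    Nat.add_sub_cancel_left, List.getD_append _ _ _ _ (by rwa [hM])]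
  exact hadj u v hu hv

theorem encode_k (x : DSInstance) (i : ℕ) :
    x.encode.getD (2 * x.n.size + 1 + x.n * x.n + i) false = (encodeNumber x.k).getD i false := by
  obtain ⟨M, hM, h, hadj⟩ := x.encode_eq
  rw [h, List.getD_append_right _ _ _ _ (by rw [length_encodeNumber]; omega), length_encodeNumber,
    List.getD_append_right _ _ _ _ (by omega)]
  congr 1
  omega

end DSInstance

theorem sum_testBit (x a : ℕ) :
    ∑ i ∈ Finset.range a, (x.testBit i).toNat * 2 ^ i = x % 2 ^ a := by
  induction a with
  | zero => simp [Nat.mod_one]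
  | succ a ih =>
    rw [Finset.sum_range_succ, ih, pow_succ, Nat.mod_mul, Nat.testBit_eq_decide_div_mod_eq, mul_comm]
    rcases Nat.mod_two_eq_zero_or_one (x / 2 ^ a) with h | h <;> simp [h]

/-! ### The parameters of the reduction -/

namespace Red

/-- The number of binary digits of `n`, plus four. -/
def A (n : ℕ) : ℕ := n.size + 4

/-- A power of two above `n`. -/
def N (n : ℕ) : ℕ := 2 ^ A n

/-- The number of parts of the vertex set. -/
def p (n : ℕ) : ℕ := A n * A n

/-- The size of a part. -/
def m (n : ℕ) : ℕ := N n / p n + 1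

/-- The exponent of the number of colors. -/
def E (n : ℕ) : ℕ := 2 * m n + p n + 1

/-- The number of colors. -/
def S (n : ℕ) : ℕ := N n ^ E n

/-- The exponent of the bound for all computations. -/
def Q (n : ℕ) : ℕ := A n * (E n + 1)

theorem four_le_A (n : ℕ) : 4 ≤ A n := by simp [A]

theorem sq_le_two_pow {a : ℕ} (ha : 4 ≤ a) : a * a ≤ 2 ^ a := by
  induction a, ha using Nat.le_induction with
  | base => norm_num
  | succ a ha ih =>
    rw [pow_succ]
    nlinarith

theorem p_le_N (n : ℕ) : p n ≤ N n := sq_le_two_pow (four_le_A n)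

theorem sixteen_le_p (n : ℕ) : 16 ≤ p n := Nat.mul_le_mul (four_le_A n) (four_le_A n)

theorem sixteen_le_N (n : ℕ) : 16 ≤ N n := (sixteen_le_p n).trans (p_le_N n)

theorem A_le_p (n : ℕ) : 4 * A n ≤ p n := Nat.mul_le_mul_right _ (four_le_A n)

theorem m_le_N (n : ℕ) : m n ≤ N n := by
  have h1 : N n / p n ≤ N n / 16 := Nat.div_le_div_left (sixteen_le_p n) (by norm_num)
  have h2 := sixteen_le_N n
  rw [m]
  omega

theorem lt_N (n : ℕ) : 16 * n < N n := by
  have := n.lt_size_self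
  rw [N, A, pow_add]
  omega

theorem le_p_mul_m (n : ℕ) : n ≤ p n * m n := by
  have h1 : N n < p n * m n := by
    have := Nat.lt_mul_div_succ (N n) (show 0 < p n by have := sixteen_le_p n; omega)
    exact this
  have := lt_N n
  omega

/-- The factor `N n ≥ 16` leaves room above the number of colors for intermediate values. -/
theorem S_mul_N (n : ℕ) : S n * N n = 2 ^ Q n := by
  rw [S, ← pow_succ, N, ← pow_mul, Q]

/-- Of the `E n` factors, `m n + p n` accommodate the right values, and the other `m n + 1` pay for
the scaling. -/
theorem le_S (n : ℕ) : 2 * 2 ^ m n * N n ^ (m n + p n) ≤ S n := by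
  have h1 : 2 ≤ N n := by have := sixteen_le_N n; omega
  have h2 : S n = N n * N n ^ m n * N n ^ (m n + p n) := by
    rw [S, E, ← pow_succ', ← pow_add]
    congr 1
    omega
  rw [h2]
  exact Nat.mul_le_mul_right _ (Nat.mul_le_mul h1 (Nat.pow_le_pow_left h1 _))

theorem N_pow_le_S (n : ℕ) : N n ^ 4 ≤ S n := by
  have := sixteen_le_p n
  have := sixteen_le_N n
  exact Nat.pow_le_pow_right (by omega) (by rw [E]; omega)

theorem two_mul_le_S (n : ℕ) : 2 * 2 ^ m n ≤ S n :=
  (Nat.le_mul_of_pos_right _ (pow_pos (by have := sixteen_le_N n; omega) _)).trans (le_S n)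

/-- This makes `Q n` computable under the preliminary cap `2 ^ (4 * A n)`. -/
theorem Q_le (n : ℕ) : Q n ≤ N n ^ 4 := by
  have h1 := sixteen_le_N n
  have h2 := m_le_N n
  have h3 := p_le_N n
  have h4 := A_le_p n
  have h5 : Q n ≤ N n * (5 * N n) := Nat.mul_le_mul (by omega) (by rw [E]; omega)
  have h6 : N n * N n * 16 ≤ N n * N n * (N n * N n) := Nat.mul_le_mul_left _ (by nlinarith)
  nlinarith

theorem A_le_Q (n : ℕ) : 4 * A n ≤ Q n := by
  have h3 := sixteen_le_p n
  rw [mul_comm, Q]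
  exact Nat.mul_le_mul_left _ (by rw [E]; omega)

/-- The bound `k`, cut off at `n`. -/
def K (n k : ℕ) : ℕ := if A n < k.size then n else k % 2 ^ A n

/-- The time bound depends on `n` only, whereas `k` may have any number of digits. With more than `A
n` digits it exceeds `n` and is no restriction. -/
theorem card_le_K_iff {n k : ℕ} (D : Finset (Fin n)) : D.card ≤ K n k ↔ D.card ≤ k := by
  have h := D.card_le_univ
  rw [Fintype.card_fin] at h
  rw [K]
  split_ifs with hk
  · have h1 := Nat.lt_size.1 hk
    have h2 := lt_N n
    rw [N] at h2
    constructor <;> intro <;> omega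
  · rw [Nat.mod_eq_of_lt (Nat.size_le.1 (not_lt.1 hk))]

/-- The instance of Generalized T-Coloring for an instance of Dominating Set. -/
noncomputable def gtc (x : DSInstance) : GTCInstance :=
  inst x.n (p x.n) (m x.n) (N x.n) (K x.n x.k) x.adj (S x.n)

theorem positive_gtc_iff (x : DSInstance) : (gtc x).Positive ↔ x.Positive := by
  have h1 := sixteen_le_p x.n
  have h2 := lt_N x.n
  rw [gtc, positive_inst_iff (le_p_mul_m _) (by omega) (by omega) (p_le_N _) (le_S _)]
  simp only [card_le_K_iff, DSInstance.Positive, DSInstance.adj]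
  simp

theorem bound_gtc (x : DSInstance) : (gtc x).bound = S x.n - 1 := by
  have h1 := sixteen_le_p x.n
  have h2 := two_mul_le_S x.n
  have h3 : 0 < 2 ^ m x.n := by positivity
  exact bound_inst (by omega) (by omega)

end Red

namespace Expr

open Red

/-! ### The expressions of the reduction -/

/-- The digits of n occupy the odd positions of its code, and `a - 4` is their number. -/
def nE (a : Expr) : Expr :=
  sum (sub a (lit 4)) (mul (bit (succ (mul (lit 2) (var 0)))) (pow (lit 2) (var 0)))

def NE (a : Expr) : Expr := pow (lit 2) a

def pE (a : Expr) : Expr := mul a a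

def mE (a : Expr) : Expr := succ (div (NE a) (pE a))

def EE (a : Expr) : Expr := succ (add (mul (lit 2) (mE a)) (pE a))

def SE (a : Expr) : Expr := pow (NE a) (EE a)

def QE (a : Expr) : Expr := mul a (succ (EE a))

/-- The position where the adjacency matrix begins. -/
def posE (a : Expr) : Expr := succ (mul (lit 2) (sub a (lit 4)))

def adjE (a u v : Expr) : Expr := bit (add (posE a) (add (mul u (nE a)) v))

/-- The bit tested first is the marker at offset `2 * a` in the code of k. -/
def KE (a : Expr) : Expr :=
  ite (bit (add (add (posE a) (mul (nE a) (nE a))) (mul (lit 2) a))) (nE a)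
    (sum a (mul (bit (add (add (posE (up a)) (mul (nE (up a)) (nE (up a))))
      (succ (mul (lit 2) (var 0))))) (pow (lit 2) (var 0))))

section

variable {x : DSInstance} {B : ℕ} {v : ℕ → ℕ} {a : Expr}

theorem V.nE (hB : N x.n ^ 4 ≤ B) (ha : V B x.encode v a (A x.n)) :
    V B x.encode v (nE a) x.n := by
  have h1 := sixteen_le_N x.n
  have h2 := lt_N x.n
  have h3 : N x.n ≤ B := (Nat.le_self_pow (by norm_num) _).trans hB
  have h4 := A_le_p x.n
  have h5 := p_le_N x.n
  have h0 : ∑ i ∈ Finset.range x.n.size, (x.n.testBit i).toNat * 2 ^ i = x.n := by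
    rw [sum_testBit, Nat.mod_eq_of_lt x.n.lt_size_self]
  have key : V B x.encode v (Expr.nE a)
      (∑ i ∈ Finset.range x.n.size, (x.n.testBit i).toNat * 2 ^ i) := by
    refine V.sum (ha.sub (V.lit (by omega))) (fun i hi => ?_) (by omega)
    rw [← x.encode_digit hi]
    have h6 : i < A x.n := by rw [A]; omega
    have h7 : 2 ^ i < N x.n := Nat.pow_lt_pow_right (by norm_num) h6
    have hv : V B x.encode (envCons i v) (var 0) i := rfl
    refine ((((V.lit (by omega)).mul hv (by omega)).succ (by omega)).bit).mul
      ((V.lit (by omega)).pow hv (by omega)) ?_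
    have := Bool.toNat_le (x.encode.getD (2 * i + 1) false)
    nlinarith
  rwa [h0] at key

theorem V.NE (hB : N x.n ^ 4 ≤ B) (ha : V B x.encode v a (A x.n)) :
    V B x.encode v (NE a) (N x.n) := by
  have h1 := sixteen_le_N x.n
  have h3 : N x.n ≤ B := (Nat.le_self_pow (by norm_num) _).trans hB
  exact (V.lit (by omega)).pow ha h3

theorem V.pE (hB : N x.n ^ 4 ≤ B) (ha : V B x.encode v a (A x.n)) :
    V B x.encode v (pE a) (p x.n) := by
  have h3 : N x.n ≤ B := (Nat.le_self_pow (by norm_num) _).trans hB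
  exact ha.mul ha ((p_le_N x.n).trans h3)

theorem N_lt (hB : N x.n ^ 4 ≤ B) : N x.n < B ∧ 16 * (N x.n * N x.n) ≤ B := by
  have h1 := sixteen_le_N x.n
  have h6 : N x.n * N x.n * 16 ≤ N x.n * N x.n * (N x.n * N x.n) :=
    Nat.mul_le_mul_left _ (by nlinarith)
  have h2 : 16 * (N x.n * N x.n) ≤ B := by nlinarith
  exact ⟨by nlinarith, h2⟩

theorem V.mE (hB : N x.n ^ 4 ≤ B) (ha : V B x.encode v a (A x.n)) :
    V B x.encode v (mE a) (m x.n) := by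
  have h1 := sixteen_le_p x.n
  exact ((V.NE hB ha).div (V.pE hB ha) (N_lt hB).1 (by omega)).succ
    ((m_le_N x.n).trans (N_lt hB).1.le)

theorem V.EE (hB : N x.n ^ 4 ≤ B) (ha : V B x.encode v a (A x.n)) :
    V B x.encode v (EE a) (E x.n) := by
  have h0 := sixteen_le_N x.n
  have h1 := p_le_N x.n
  have h2 := m_le_N x.n
  have h3 := (N_lt hB).2
  have h4 : 16 * (1 * N x.n) ≤ 16 * (N x.n * N x.n) :=
    Nat.mul_le_mul_left _ (Nat.mul_le_mul_right _ (by omega))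
  exact (((V.lit (by omega)).mul (V.mE hB ha) (by omega)).add (V.pE hB ha) (by omega)).succ
    (by omega)

theorem V.QE (hB : N x.n ^ 4 ≤ B) (ha : V B x.encode v a (A x.n)) :
    V B x.encode v (QE a) (Q x.n) := by
  have h0 := sixteen_le_N x.n
  have h1 := p_le_N x.n
  have h2 := m_le_N x.n
  have h3 := (N_lt hB).2
  have h4 : 16 * (1 * N x.n) ≤ 16 * (N x.n * N x.n) :=
    Nat.mul_le_mul_left _ (Nat.mul_le_mul_right _ (by omega))
  exact ha.mul ((V.EE hB ha).succ (by rw [E]; omega)) ((Q_le x.n).trans hB)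

theorem V.SE (hB : N x.n ^ 4 ≤ B) (hS : S x.n ≤ B) (ha : V B x.encode v a (A x.n)) :
    V B x.encode v (SE a) (S x.n) :=
  (V.NE hB ha).pow (V.EE hB ha) hS

theorem V.posE (hB : N x.n ^ 4 ≤ B) (ha : V B x.encode v a (A x.n)) :
    V B x.encode v (posE a) (2 * x.n.size + 1) := by
  have h0 := sixteen_le_N x.n
  have h1 := p_le_N x.n
  have h2 := A_le_p x.n
  have h3 := (N_lt hB).1
  have h4 : A x.n = x.n.size + 4 := rfl
  exact ((V.lit (by omega)).mul (ha.sub (V.lit (by omega))) (by omega)).succ (by omega)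

theorem H.adjE {eu ev : Expr} {y z : ℕ} (hB : N x.n ^ 4 ≤ B) (ha : V B x.encode v a (A x.n))
    (hu : V B x.encode v eu y) (hv : V B x.encode v ev z) (hy : y < x.n) (hz : z < x.n) :
    H B x.encode v (adjE a eu ev) (x.adj y z) := by
  have h0 := sixteen_le_N x.n
  have h1 := p_le_N x.n
  have h2 := A_le_p x.n
  have h3 := (N_lt hB).2
  have h4 : A x.n = x.n.size + 4 := rfl
  have h5 := lt_N x.n
  have h6 : y * x.n + z ≤ N x.n * N x.n := by nlinarith
  have h7 : 16 * (1 * N x.n) ≤ 16 * (N x.n * N x.n) :=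
    Nat.mul_le_mul_left _ (Nat.mul_le_mul_right _ (by omega))
  refine (H.of_V ((V.posE hB ha).add ((hu.mul (V.nE hB ha) (by omega)).add hv (by omega))
    (by omega)).bit).congr ?_
  rw [← x.encode_adj hy hz]
  cases x.encode.getD (2 * x.n.size + 1 + (y * x.n + z)) false <;> simp

theorem V.KE (hB : N x.n ^ 4 ≤ B) (ha : V B x.encode v a (A x.n)) :
    V B x.encode v (KE a) (K x.n x.k) := by
  have h0 := sixteen_le_N x.n
  have h1 := p_le_N x.n
  have h2 := A_le_p x.n
  have h3 := (N_lt hB).2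
  have h4 : A x.n = x.n.size + 4 := rfl
  have h5 := lt_N x.n
  have h6 : x.n * x.n ≤ N x.n * N x.n := Nat.mul_le_mul (by omega) (by omega)
  have h7 : 16 * (1 * N x.n) ≤ 16 * (N x.n * N x.n) :=
    Nat.mul_le_mul_left _ (Nat.mul_le_mul_right _ (by omega))
  refine V.ite ?_ (fun _ => V.nE hB ha) fun hk => ?_
  · refine (H.of_V (((V.posE hB ha).add ((V.nE hB ha).mul (V.nE hB ha) (by omega))
      (by omega)).add ((V.lit (by omega)).mul ha (by omega)) (by omega)).bit).congr ?_
    rw [x.encode_k, (getD_encodeNumber _ _).1]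
    by_cases h : A x.n < x.k.size <;> simp [h]
  · have hs := sum_testBit x.k (A x.n)
    have hl : x.k % 2 ^ A x.n < N x.n := Nat.mod_lt _ (by positivity)
    rw [← hs] at hl ⊢
    refine V.sum ha (fun i hi => ?_) (by omega)
    have ha' := ha.up (z := i)
    have hv : V B x.encode (envCons i v) (var 0) i := rfl
    have h8 : 2 ^ i < N x.n := Nat.pow_lt_pow_right (by norm_num) hi
    rw [← (getD_encodeNumber _ _).2, ← x.encode_k]
    refine ((((V.posE hB ha').add ((V.nE hB ha').mul (V.nE hB ha') (by omega)) (by omega)).add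
      (((V.lit (by omega)).mul hv (by omega)).succ (by omega)) (by omega)).bit).mul
      ((V.lit (by omega)).pow hv (by omega)) ?_
    have := Bool.toNat_le (x.encode.getD (2 * x.n.size + 1 + x.n * x.n + (2 * i + 1)) false)
    nlinarith

end

end Expr

namespace Expr

open Red

/-- The relation `Red.Rel`; the variables are the value `a` of the left variable, the value `b` of
the right variable, the distance, the right variable, the left variable, and `Red.A n`. -/
def relE : Expr :=
  and
    (imp (lt (sub (var 3) (pE (var 5))) (pE (var 5)))
      (all (mE (var 5))
        (imp (eq (digit (pE (var 6)) (var 2) (var 0)) (var 5))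
          (imp (lt (add (mul (sub (var 4) (pE (var 6))) (mE (var 6))) (var 0)) (nE (var 6)))
            (ex (mE (var 6))
              (and (digit (lit 2) (var 2) (var 0))
                (and (lt (add (mul (var 6) (mE (var 7))) (var 0)) (nE (var 7)))
                  (or (eq (add (mul (var 6) (mE (var 7))) (var 0))
                      (add (mul (sub (var 5) (pE (var 7))) (mE (var 7))) (var 1)))
                    (adjE (var 7) (add (mul (var 6) (mE (var 7))) (var 0))
                      (add (mul (sub (var 5) (pE (var 7))) (mE (var 7))) (var 1)))))))))))
    (imp (eq (sub (var 3) (pE (var 5))) (pE (var 5)))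
      (and (le (sum (mE (var 5)) (digit (lit 2) (var 1) (var 0)))
          (digit (NE (var 5)) (var 1) (var 4)))
        (le (sum (pE (var 5)) (digit (NE (var 6)) (var 2) (var 0))) (KE (var 5)))))

section

variable {x : DSInstance} {B : ℕ} {v : ℕ → ℕ}

theorem H.relE (hB : N x.n ^ 4 ≤ B) {a b u y : ℕ} (h0 : v 0 = a) (h1 : v 1 = b) (h3 : v 3 = y)
    (h4 : v 4 = u) (h5 : v 5 = A x.n) (ha : a < B) (hb : b < B) (hu : u < p x.n)
    (hy : y ≤ 2 * p x.n) :
    H B x.encode v relE (Rel x.n (p x.n) (m x.n) (N x.n) (K x.n x.k) x.adj u (y - p x.n) a b) := by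
  have n0 := sixteen_le_N x.n
  have n1 := p_le_N x.n
  have n2 := m_le_N x.n
  have n3 := (N_lt hB).2
  have n4 := (N_lt hB).1
  have n5 := lt_N x.n
  have n6 := sixteen_le_p x.n
  have hB1 : 1 ≤ B := by omega
  have n7 : 16 * (1 * N x.n) ≤ 16 * (N x.n * N x.n) :=
    Nat.mul_le_mul_left _ (Nat.mul_le_mul_right _ (by omega))
  have n8 : ∀ i ≤ p x.n, i * m x.n ≤ N x.n * N x.n := fun i hi =>
    Nat.mul_le_mul (by omega) n2
  have hA : V B x.encode v (var 5) (A x.n) := h5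
  have hj : V B x.encode v (sub (var 3) (pE (var 5))) (y - p x.n) :=
    V.sub (show V B x.encode v (var 3) y from h3) (V.pE hB hA)
  have hjp : y - p x.n ≤ p x.n := by omega
  have n9 := n8 _ hjp
  have n10 := n8 _ hu.le
  refine (H.imp hB1 (H.lt hB1 hj (V.pE hB hA)) fun hjp' => ?_).and hB1 fun _ =>
    H.imp hB1 (H.eq hB1 hj (V.pE hB hA)) fun hjp' => ?_
  · refine H.all hB1 (V.mE hB hA) fun t ht => ?_
    have hA' : V B x.encode (envCons t v) (var 6) (A x.n) := h5
    have ht' : V B x.encode (envCons t v) (var 0) t := rfl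
    have hj' : V B x.encode (envCons t v) (sub (var 4) (pE (var 6))) (y - p x.n) :=
      V.sub (show V B x.encode (envCons t v) (var 4) y from h3) (V.pE hB hA')
    refine H.imp hB1 (H.eq hB1 (V.digit (show V B x.encode (envCons t v) (var 2) b from h1)
      (V.pE hB hA') ht' hb (by omega)) (show V B x.encode (envCons t v) (var 5) u from h4)) fun _ => ?_
    refine H.imp hB1 (H.lt hB1 ((hj'.mul (V.mE hB hA') (by omega)).add ht' (by omega))
      (V.nE hB hA')) fun hlt => ?_
    refine H.ex hB1 (V.mE hB hA') fun t' ht' => ?_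
    set v' := envCons t' (envCons t v) with hv'
    have hA'' : V B x.encode v' (var 7) (A x.n) := h5
    have hj'' : V B x.encode v' (sub (var 5) (pE (var 7))) (y - p x.n) :=
      V.sub (show V B x.encode v' (var 5) y from h3) (V.pE hB hA'')
    have hL : V B x.encode v' (add (mul (var 6) (mE (var 7))) (var 0)) (u * m x.n + t') :=
      (V.mul (show V B x.encode v' (var 6) u from h4) (V.mE hB hA'') (by omega)).add
        (rfl : V B x.encode v' (var 0) t') (by omega)
    have hR : V B x.encode v' (add (mul (sub (var 5) (pE (var 7))) (mE (var 7))) (var 1))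
        ((y - p x.n) * m x.n + t) :=
      (hj''.mul (V.mE hB hA'') (by omega)).add (rfl : V B x.encode v' (var 1) t) (by omega)
    refine (H.of_V (V.digit (show V B x.encode v' (var 2) a from h0) (V.lit (by omega))
      (rfl : V B x.encode v' (var 0) t') ha (by norm_num))).and hB1 fun _ => ?_
    refine (H.lt hB1 hL (V.nE hB hA'')).and hB1 fun hlt' => ?_
    exact (H.eq hB1 hL hR).or hB1 fun _ => H.adjE hB hA'' hL hR hlt' hlt
  · have s1 : ∑ t ∈ Finset.range (m x.n), dig 2 a t ≤ m x.n := by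
      refine (Finset.sum_le_card_nsmul _ _ 1 fun t _ => ?_).trans (by simp)
      have : dig 2 a t < 2 := Nat.mod_lt _ (by norm_num)
      omega
    have s2 : ∑ t ∈ Finset.range (p x.n), dig (N x.n) b t ≤ p x.n * N x.n := by
      refine (Finset.sum_le_card_nsmul _ _ (N x.n) fun t _ => ?_).trans (by simp)
      exact (Nat.mod_lt _ (by omega)).le
    have s3 : p x.n * N x.n ≤ N x.n * N x.n := Nat.mul_le_mul_right _ n1
    refine (H.le hB1 (V.sum (V.mE hB hA) (fun t ht => ?_) (by omega))
      (V.digit (show V B x.encode v (var 1) b from h1) (V.NE hB hA)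
        (show V B x.encode v (var 4) u from h4) hb (by omega))).and hB1 fun _ =>
      H.le hB1 (V.sum (V.pE hB hA) (fun t ht => ?_) (by omega)) (V.KE hB hA)
    · exact V.digit (show V B x.encode (envCons t v) (var 1) a from h0) (V.lit (by omega))
        (rfl : V B x.encode (envCons t v) (var 0) t) ha (by norm_num)
    · exact V.digit (show V B x.encode (envCons t v) (var 2) b from h1)
        (V.NE hB (show V B x.encode (envCons t v) (var 6) (A x.n) from h5))
        (rfl : V B x.encode (envCons t v) (var 0) t) hb (by omega)

end

/-- Twice two to the size of a part. -/
def WE (a : Expr) : Expr := mul (lit 2) (pow (lit 2) (mE a))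

/-- The relation `Red.Forb`; the variables are the distance, the second and the first vertex, and
`Red.A n`. -/
def forbE : Expr :=
  or (and (eq (var 1) (succ (mul (lit 2) (pE (var 3)))))
      (and (lt (var 2) (pE (var 3))) (le (pow (lit 2) (mE (var 3))) (var 0))))
    (or (and (eq (var 1) (succ (mul (lit 2) (pE (var 3)))))
        (and (le (pE (var 3)) (var 2)) (and (le (var 2) (mul (lit 2) (pE (var 3))))
          (mod (var 0) (WE (var 3))))))
      (and (lt (var 2) (pE (var 3))) (and (le (pE (var 3)) (var 1))
        (and (le (var 1) (mul (lit 2) (pE (var 3))))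
          (not (lett (div (add (var 0) (pow (lit 2) (mE (var 3)))) (WE (var 3)))
            (lett (add (sub (var 1) (mul (WE (var 4)) (var 0)))
              (sub (mul (WE (var 4)) (var 0)) (var 1))) relE)))))))

section

variable {x : DSInstance} {B : ℕ} {v : ℕ → ℕ}

theorem H.forbE (hB : S x.n * N x.n ≤ B) {d u y : ℕ} (h0 : v 0 = d) (h1 : v 1 = y) (h2 : v 2 = u)
    (h3 : v 3 = A x.n) (hd : d < S x.n) :
    H B x.encode v forbE
      (Forb x.n (p x.n) (m x.n) (N x.n) (K x.n x.k) x.adj u y d) := by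
  have n0 := sixteen_le_N x.n
  have n1 := p_le_N x.n
  have n2 := N_pow_le_S x.n
  -- Room for `d + 2 ^ m` and for the nearby multiple of `2 * 2 ^ m`, both below `2 * S x.n`.
  have n3 : 16 * S x.n ≤ B := by nlinarith
  have hB4 : N x.n ^ 4 ≤ B := by omega
  have n4 := (N_lt hB4).2
  have n5 := (N_lt hB4).1
  have n6 := two_mul_le_S x.n
  have n7 : 0 < 2 ^ m x.n := by positivity
  have n8 : 16 * (1 * N x.n) ≤ 16 * (N x.n * N x.n) :=
    Nat.mul_le_mul_left _ (Nat.mul_le_mul_right _ (by omega))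
  have hB1 : 1 ≤ B := by omega
  have hA : V B x.encode v (var 3) (A x.n) := h3
  have e0 : V B x.encode v (var 0) d := h0
  have e1 : V B x.encode v (var 1) y := h1
  have e2 : V B x.encode v (var 2) u := h2
  have hp := V.pE hB4 hA
  have h2p : V B x.encode v (mul (lit 2) (pE (var 3))) (2 * p x.n) :=
    (V.lit (by omega)).mul hp (by omega)
  have hz := h2p.succ (by omega)
  have hM : V B x.encode v (pow (lit 2) (mE (var 3))) (2 ^ m x.n) :=
    (V.lit (by omega)).pow (V.mE hB4 hA) (by omega)
  have hW : V B x.encode v (WE (var 3)) (2 * 2 ^ m x.n) := (V.lit (by omega)).mul hM (by omega)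
  refine H.or hB1 ((H.eq hB1 e1 hz).and hB1 fun _ => (H.lt hB1 e2 hp).and hB1 fun _ =>
    H.le hB1 hM e0) fun _ => ?_
  refine H.or hB1 ((H.eq hB1 e1 hz).and hB1 fun _ => (H.le hB1 hp e2).and hB1 fun _ =>
    (H.le hB1 e2 h2p).and hB1 fun _ => H.of_V (e0.mod hW (by omega) (by omega))) fun _ => ?_
  refine (H.lt hB1 e2 hp).and hB1 fun hu => (H.le hB1 hp e1).and hB1 fun _ =>
    (H.le hB1 e1 h2p).and hB1 fun hy => H.not hB1 ?_
  set b := (d + 2 ^ m x.n) / (2 * 2 ^ m x.n) with hb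
  have hbd : 2 * 2 ^ m x.n * b ≤ d + 2 ^ m x.n := Nat.mul_div_le _ _
  have hbB : b ≤ d + 2 ^ m x.n := Nat.div_le_self _ _
  refine H.lett ((e0.add hM (by omega)).div hW (by omega) (by omega)) ?_
  have hA' : V B x.encode (envCons b v) (var 4) (A x.n) := h3
  have hW' : V B x.encode (envCons b v) (WE (var 4)) (2 * 2 ^ m x.n) :=
    (V.lit (by omega)).mul ((V.lit (by omega)).pow (V.mE hB4 hA') (by omega)) (by omega)
  have hWb : V B x.encode (envCons b v) (mul (WE (var 4)) (var 0)) (2 * 2 ^ m x.n * b) :=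
    hW'.mul (rfl : V B x.encode (envCons b v) (var 0) b) (by omega)
  have e0' : V B x.encode (envCons b v) (var 1) d := h0
  refine H.lett ((e0'.sub hWb).add (hWb.sub e0') (by omega)) ?_
  exact H.relE hB4 rfl rfl h1 h2 h3 (by omega) (by omega) hu hy

end

end Expr

/-! ### Printing the T-coloring instance -/

namespace Gen

open Expr Red

/-- The encoding of the instance `Red.gtc x`, from `Red.A n`. -/
def gtcE : Gen :=
  seq (number (mul (lit 2) (succ (pE (var 0))))) <| seq
    (forr (mul (lit 2) (succ (pE (var 0)))) <| forr (mul (lit 2) (succ (pE (var 1)))) <|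
      seq (when (Expr.eq (var 0) (var 1)) (emit zero)) <|
        when (Expr.not (Expr.eq (var 0) (var 1))) <| seq (emit (lit 1)) <| seq
          (forr (SE (var 3)) <|
            when (Expr.or (ren (envCons 0 (envCons 2 (envCons 3 fun _ => 4))) forbE)
              (ren (envCons 0 (envCons 3 (envCons 2 fun _ => 4))) forbE)) <|
            seq (emit (lit 1)) (number (var 1)))
          (emit zero)) <|
  number (SE (var 0))

theorem flatMap_finRange {α : Type*} (n : ℕ) (f : ℕ → List α) :
    (List.finRange n).flatMap (fun i : Fin n => f i) = (List.range n).flatMap f := by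
  rw [← List.map_coe_finRange_eq_range, List.flatMap_map]

theorem flatMap_filter {α : Type*} (P : ℕ → Prop) [DecidablePred P] (f : ℕ → List α) :
    ∀ l : List ℕ, (l.filter P).flatMap f = l.flatMap fun d => if P d then f d else []
  | [] => rfl
  | a :: l => by
    by_cases h : P a <;> simp [h, flatMap_filter P f l]

/-- Testing the candidates in increasing order already yields the sorted list of members, so the
machine need not sort. -/
theorem encodeSet_filter_range (s : ℕ) (P : ℕ → Prop) [DecidablePred P] :
    encodeSet ((Finset.range s).filter P) =
      ((List.range s).flatMap fun d => if P d then true :: encodeNumber d else []) ++ [false] := by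
  have : ((Finset.range s).filter P).sort (· ≤ ·) = (List.range s).filter P := by
    have h1 : ((List.range s).filter P).toFinset = (Finset.range s).filter P := by
      ext
      simp
    rw [← h1, List.toFinset_sort _ (List.nodup_range.filter _)]
    exact List.pairwise_le_range.filter _
  rw [encodeSet, this, flatMap_filter]

section

variable {x : DSInstance} {B : ℕ}

theorem encodeSet_gtc {u y : Fin (2 * p x.n + 2)} (h : (gtc x).G.Adj u y) :
    encodeSet ((gtc x).t ⟨s(u, y), h⟩) = ((List.range (S x.n)).flatMap fun d =>
      open Classical in
      if Forb x.n (p x.n) (m x.n) (N x.n) (K x.n x.k) x.adj u y d ∨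
        Forb x.n (p x.n) (m x.n) (N x.n) (K x.n x.k) x.adj y u d
      then true :: encodeNumber d else []) ++ [false] := by
  classical
  rw [← encodeSet_filter_range]
  congr 1
  ext d
  rw [Finset.mem_filter, Finset.mem_range]
  exact mem_t h d

/-- Inside the loop the variables are the distance, the dummy variable of the outer `when`, the
column, the row and `A n`; the renamings pick these out. Both orders of the vertices are tested
because `Forb` is not symmetric. -/
theorem out_set (hB : S x.n * N x.n ≤ B) {v : ℕ → ℕ} {u y : ℕ} (h1 : v 1 = y) (h2 : v 2 = u)
    (h3 : v 3 = A x.n) :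
    (forr (SE (var 3)) <|
      when (Expr.or (ren (envCons 0 (envCons 2 (envCons 3 fun _ => 4))) forbE)
        (ren (envCons 0 (envCons 3 (envCons 2 fun _ => 4))) forbE)) <|
      seq (emit (lit 1)) (number (var 1))).out B x.encode v =
    (List.range (S x.n)).flatMap fun d =>
      open Classical in
      if Forb x.n (p x.n) (m x.n) (N x.n) (K x.n x.k) x.adj u y d ∨
        Forb x.n (p x.n) (m x.n) (N x.n) (K x.n x.k) x.adj y u d
      then true :: encodeNumber d else [] := by
  have n0 := sixteen_le_N x.n
  have n2 := N_pow_le_S x.n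
  have n3 : 16 * S x.n ≤ B := by nlinarith
  have n4 : 0 < N x.n ^ 4 := by positivity
  have hB4 : N x.n ^ 4 ≤ B := by omega
  have hB1 : 1 ≤ B := by omega
  have hS : V B x.encode v (SE (var 3)) (S x.n) := V.SE hB4 (by omega) h3
  rw [out, show eval B x.encode _ _ = _ from hS]
  refine List.flatMap_congr fun d hd => ?_
  have hd := List.mem_range.1 hd
  refine out_when (inst := _) hB1 ?_ fun _ => ?_
  · exact H.or hB1 (H.forbE (v := fun i => envCons d v _) hB rfl h1 h2 h3 hd) fun _ =>
      H.forbE (v := fun i => envCons d v _) hB rfl h2 h1 h3 hd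
  · have e1 : eval B x.encode (lit 1) (envCons 0 (envCons d v)) = 1 := V.lit hB1
    have e2 : V B x.encode (envCons 0 (envCons d v)) (var 1) d := rfl
    rw [out, out, e1, out_number (by omega) e2 (by omega)]
    rfl

theorem out_entry (hB : S x.n * N x.n ≤ B) {v : ℕ → ℕ} {u y : ℕ} (h0 : v 0 = y) (h1 : v 1 = u)
    (h2 : v 2 = A x.n) :
    (seq (when (Expr.eq (var 0) (var 1)) (emit zero)) <|
        when (Expr.not (Expr.eq (var 0) (var 1))) <| seq (emit (lit 1)) <| seq
          (forr (SE (var 3)) <|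
            when (Expr.or (ren (envCons 0 (envCons 2 (envCons 3 fun _ => 4))) forbE)
              (ren (envCons 0 (envCons 3 (envCons 2 fun _ => 4))) forbE)) <|
            seq (emit (lit 1)) (number (var 1)))
          (emit zero)).out B x.encode v =
    if y = u then [false] else true :: (((List.range (S x.n)).flatMap fun d =>
      open Classical in
      if Forb x.n (p x.n) (m x.n) (N x.n) (K x.n x.k) x.adj u y d ∨
        Forb x.n (p x.n) (m x.n) (N x.n) (K x.n x.k) x.adj y u d
      then true :: encodeNumber d else []) ++ [false]) := by
  have n0 := sixteen_le_N x.n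
  have n2 := N_pow_le_S x.n
  have n4 : 0 < N x.n ^ 4 := by positivity
  have hB1 : 1 ≤ B := by nlinarith
  have hE : H B x.encode v (Expr.eq (var 0) (var 1)) (y = u) :=
    H.eq hB1 (show V B x.encode v (var 0) y from h0) h1
  have e1 : eval B x.encode (lit 1) (envCons 0 v) = 1 := V.lit hB1
  rw [out, out_when (l := [false]) hB1 hE (fun _ => rfl), out_when hB1 (hE.not hB1) (fun _ => rfl),
    out, out, e1, out, out_set hB h0 h1 h2]
  by_cases h : y = u
  · simp [h]
  · simp [h]
    rfl

theorem out_gtcE (hB : S x.n * N x.n ≤ B) :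
    gtcE.out B x.encode (Cmd.env₀ (A x.n)) = (gtc x).encode := by
  have n0 := sixteen_le_N x.n
  have n1 := p_le_N x.n
  have n2 := N_pow_le_S x.n
  have n3 : 16 * S x.n ≤ B := by nlinarith
  have n4 : 0 < N x.n ^ 4 := by positivity
  have hB4 : N x.n ^ 4 ≤ B := by omega
  have n5 := (N_lt hB4).2
  have n6 := (N_lt hB4).1
  have n8 : 16 * (1 * N x.n) ≤ 16 * (N x.n * N x.n) :=
    Nat.mul_le_mul_left _ (Nat.mul_le_mul_right _ (by omega))
  have hB2 : 2 ≤ B := by omega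
  have hn : ∀ {v : ℕ → ℕ} {a : Expr}, V B x.encode v a (A x.n) →
      V B x.encode v (mul (lit 2) (succ (pE a))) (2 * p x.n + 2) := fun ha =>
    (V.lit hB2).mul ((V.pE hB4 ha).succ (by omega)) (by omega)
  have h0 : V B x.encode (Cmd.env₀ (A x.n)) (var 0) (A x.n) := rfl
  have hS : V B x.encode (Cmd.env₀ (A x.n)) (SE (var 0)) (S x.n) := V.SE hB4 (by omega) h0
  have hmat : (forr (mul (lit 2) (succ (pE (var 0)))) <|
      forr (mul (lit 2) (succ (pE (var 1)))) <|
      seq (when (Expr.eq (var 0) (var 1)) (emit zero)) <|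
        when (Expr.not (Expr.eq (var 0) (var 1))) <| seq (emit (lit 1)) <| seq
          (forr (SE (var 3)) <|
            when (Expr.or (ren (envCons 0 (envCons 2 (envCons 3 fun _ => 4))) forbE)
              (ren (envCons 0 (envCons 3 (envCons 2 fun _ => 4))) forbE)) <|
            seq (emit (lit 1)) (number (var 1)))
          (emit zero)).out B x.encode (Cmd.env₀ (A x.n)) =
    (List.range (2 * p x.n + 2)).flatMap fun u => (List.range (2 * p x.n + 2)).flatMap fun y =>
      if y = u then [false] else true :: (((List.range (S x.n)).flatMap fun d =>
      open Classical in
      if Forb x.n (p x.n) (m x.n) (N x.n) (K x.n x.k) x.adj u y d ∨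
        Forb x.n (p x.n) (m x.n) (N x.n) (K x.n x.k) x.adj y u d
      then true :: encodeNumber d else []) ++ [false]) := by
    rw [out, show eval B x.encode _ _ = _ from hn h0]
    refine List.flatMap_congr fun u _ => ?_
    have h1 : V B x.encode (envCons u (Cmd.env₀ (A x.n))) (var 1) (A x.n) := rfl
    rw [out, show eval B x.encode _ _ = _ from hn h1]
    refine List.flatMap_congr fun y _ => ?_
    exact out_entry hB rfl rfl rfl
  rw [gtcE, out, out, out_number hB2 (hn h0) (by omega), out_number hB2 hS (by omega), hmat,
    GTCInstance.encode, List.append_assoc, encodeMatrix]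
  congr 2
  rw [← flatMap_finRange]
  refine List.flatMap_congr fun u _ => ?_
  rw [← flatMap_finRange]
  refine List.flatMap_congr fun y _ => ?_
  -- The target graph is complete, so exactly the diagonal entries are non-edges.
  by_cases h : (y : ℕ) = u
  · have h1 : ¬ (gtc x).G.Adj u y := by
      rw [Fin.ext h]
      exact (gtc x).G.irrefl
    rw [if_pos h, dif_neg h1]
  · have h1 : (gtc x).G.Adj u y := fun h2 => h (congrArg Fin.val h2.symm)
    rw [if_neg h, dif_pos h1, encodeSet_gtc]

end

end Gen

/-! ### The reduction as a machine -/

namespace Red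

open Polynomial in
theorem exists_machine (M : Machine) : ∃ (M' : Machine) (P R : ℕ[X]), ∀ x : DSInstance,
    (gtc x).bitSize ≤ R.eval (2 ^ Q x.n) ∧ ∀ T b, M.AnswersWithin (gtc x).encode b T →
      ∃ t ≤ P.eval (2 ^ Q x.n), M'.AnswersWithin x.encode b (t + T) := by
  obtain ⟨P, hP⟩ := Cmd.runsIn_generate (Expr.QE (Expr.var 0)) Gen.gtcE
  obtain ⟨R, hR⟩ := Gen.gtcE.length_out_le
  obtain ⟨k, hk⟩ := Cmd.exists_keysLe (Cmd.generate (Expr.QE (Expr.var 0)) Gen.gtcE)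
  refine ⟨M.precomp (Cmd.generate (Expr.QE (Expr.var 0)) Gen.gtcE) k, P, R, fun x => ?_⟩
  have hout := Gen.out_gtcE (x := x) (S_mul_N x.n).le
  refine ⟨?_, fun T b h => ?_⟩
  · rw [GTCInstance.bitSize, ← hout]
    refine hR _ Nat.one_le_two_pow fun i => ?_
    have h1 := A_le_Q x.n
    have h2 := (Q x.n).lt_two_pow_self
    rcases i with _ | i
    · change A x.n ≤ _
      omega
    · exact Nat.zero_le _
  · obtain ⟨W, -, hW, -⟩ := x.encode_eq
    have hQ : (Expr.QE (Expr.var 0)).eval (2 ^ (4 * A x.n)) x.encode (Cmd.env₀ (A x.n)) = Q x.n :=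
      Expr.V.QE (by rw [N, ← pow_mul, mul_comm]) rfl
    rw [hW] at hQ hout ⊢
    obtain ⟨s', ⟨t, ht, hr⟩, hs⟩ := hP x.n _ _ hQ (A_le_Q x.n)
    exact ⟨t, ht, M.precomp_answersWithin _ k hk hr (hs.trans hout) h⟩

open Polynomial in
-- The exponent uses `q + 1` so that constants are absorbed even at `q = 0`.
theorem exists_eval_two_pow_le (P : ℕ[X]) : ∃ C, ∀ q, P.eval (2 ^ q) ≤ 2 ^ (C * (q + 1)) := by
  induction P using Polynomial.induction_on' with
  | add P R hP hR =>
    obtain ⟨C, hC⟩ := hP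
    obtain ⟨D, hD⟩ := hR
    refine ⟨C + D + 1, fun q => ?_⟩
    rw [eval_add]
    have h1 : 2 ^ (C * (q + 1)) ≤ 2 ^ ((C + D) * (q + 1)) :=
      Nat.pow_le_pow_right (by norm_num) (Nat.mul_le_mul_right _ (by omega))
    have h2 : 2 ^ (D * (q + 1)) ≤ 2 ^ ((C + D) * (q + 1)) :=
      Nat.pow_le_pow_right (by norm_num) (Nat.mul_le_mul_right _ (by omega))
    calc P.eval (2 ^ q) + R.eval (2 ^ q) ≤ 2 ^ ((C + D) * (q + 1) + 1) := by
          rw [pow_succ]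
          have := hC q
          have := hD q
          omega
      _ ≤ _ := Nat.pow_le_pow_right (by norm_num) (by ring_nf; omega)
  | monomial k a =>
    refine ⟨a + k, fun q => ?_⟩
    rw [eval_monomial, ← pow_mul]
    calc a * 2 ^ (q * k) ≤ 2 ^ a * 2 ^ (q * k) := Nat.mul_le_mul_right _ a.lt_two_pow_self.le
      _ = 2 ^ (a + q * k) := (pow_add _ _ _).symm
      _ ≤ _ := Nat.pow_le_pow_right (by norm_num) (by ring_nf; omega)

/-! ### Asymptotics of the parameters and the two time bounds -/

theorem tendsto_A : Tendsto A atTop atTop :=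
  tendsto_atTop.2 fun b => (eventually_ge_atTop (2 ^ b)).mono fun n hn => by
    have := Nat.lt_size.2 hn
    rw [A]
    omega

theorem N_isBigO : (fun n => (2 : ℝ) ^ A n) =O[atTop] fun n => (n : ℝ) := by
  -- The constant is `2 ^ 5`: `A n = n.size + 4`, and `2 ^ (n.size - 1) ≤ n`.
  refine IsBigO.of_bound 32 ((eventually_ge_atTop 1).mono fun n hn => ?_)
  have h1 : 2 ^ (n.size - 1) ≤ n := Nat.lt_size.1 (by
    have := Nat.size_pos.2 hn
    omega)
  have h2 : 2 ^ A n = 32 * 2 ^ (n.size - 1) := by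
    have := Nat.size_pos.2 hn
    rw [show A n = 5 + (n.size - 1) by rw [A]; omega, pow_add]
    norm_num
  rw [Real.norm_of_nonneg (by positivity), Real.norm_of_nonneg (by positivity)]
  exact_mod_cast h2.le.trans (Nat.mul_le_mul_left _ h1)

theorem isLittleO_of_A {φ : ℕ → ℝ} (h : φ =o[atTop] fun a : ℕ => (2 : ℝ) ^ a) :
    (fun n => φ (A n)) =o[atTop] fun n => (n : ℝ) :=
  (h.comp_tendsto tendsto_A).trans_isBigO N_isBigO

/-- The main term is 2A · N/p, which equals 2 · 2^A / A because p = A². Taking A² parts rather than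
A is what makes `Q` sublinear in n. -/
theorem cast_Q_le (n : ℕ) : (Q n : ℝ) ≤ 2 * (2 ^ A n * (A n : ℝ)⁻¹) + 5 * (A n : ℝ) ^ 3 := by
  have hA : (4 : ℝ) ≤ A n := by exact_mod_cast four_le_A n
  have h1 : ((N n / p n : ℕ) : ℝ) ≤ N n / p n := Nat.cast_div_le
  have h2 : (Q n : ℝ) = A n * (2 * ((N n / p n : ℕ) + 1) + A n * A n + 1 + 1) := by
    rw [Q, E, m]
    push_cast [p]
    ring
  have h3 : A n * ((N n : ℝ) / p n) = 2 ^ A n * (A n : ℝ)⁻¹ := by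
    push_cast [N, p]
    field_simp
  rw [h2, ← h3]
  have h4 : (A n : ℝ) * (N n / p n : ℕ) ≤ A n * (N n / p n) :=
    mul_le_mul_of_nonneg_left h1 (by positivity)
  have h5 : (4 : ℝ) * A n ≤ 4 * (A n) ^ 3 := by nlinarith [sq_nonneg (A n : ℝ)]
  nlinarith

theorem Q_isLittleO : (fun n => (Q n : ℝ)) =o[atTop] fun n => (n : ℝ) := by
  have h1 : (fun a : ℕ => (2 : ℝ) ^ a * (a : ℝ)⁻¹) =o[atTop] fun a : ℕ => (2 : ℝ) ^ a := by
    have := (isBigO_refl (fun a : ℕ => (2 : ℝ) ^ a) atTop).mul_isLittleO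
      ((isLittleO_one_iff ℝ).2 (tendsto_inv_atTop_nhds_zero_nat (𝕜 := ℝ)))
    simpa using this
  have h2 := isLittleO_pow_const_const_pow_of_one_lt (R := ℝ) 3 (one_lt_two (α := ℝ))
  refine IsBigO.trans_isLittleO ?_
    (isLittleO_of_A ((h1.const_mul_left 2).add (h2.const_mul_left 5)))
  refine IsBigO.of_bound 1 (Eventually.of_forall fun n => ?_)
  rw [Real.norm_of_nonneg (by positivity), Real.norm_of_nonneg (by positivity), one_mul]
  exact cast_Q_le n

/-- Translation time and the polynomial in the bit size are both 2^O(Q), and Q = o(n). Hence only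
the superpolynomial factor of the given algorithm has to be estimated. -/
theorem dsSolvable_of_le {M : Machine} {time : GTCInstance → ℝ} {P : Polynomial ℕ} {τ : ℕ → ℝ}
    (hM : SolvesInTime M GTCInstance.encode GTCInstance.Positive time)
    (hτ : τ =o[atTop] fun n => (n : ℝ))
    (ht : ∀ x, time (gtc x) ≤ (2 : ℝ) ^ τ x.n * ((P.eval (gtc x).bitSize : ℕ) : ℝ)) :
    DSSolvableSubexp := by
  obtain ⟨M', P', R, h⟩ := exists_machine M
  obtain ⟨C, hC⟩ := exists_eval_two_pow_le P'
  obtain ⟨D, hD⟩ := exists_eval_two_pow_le (P.comp R)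
  -- The norm of `τ` makes its factor at least 1, so it can also multiply the translation time; the
  -- additional 1 beside `C + D` pays for adding the two times.
  refine ⟨M', fun n => (C + D + 1 : ℕ) * ((Q n : ℝ) + 1) + ‖τ n‖, ?_, fun x => ?_⟩
  · refine ((Q_isLittleO.add ?_).const_mul_left _).add hτ.norm_left
    exact isLittleO_const_left.2 (Or.inr (tendsto_norm_atTop_atTop.comp
      tendsto_natCast_atTop_atTop))
  · obtain ⟨T, b, hT, hb, hPos⟩ := hM (gtc x)
    obtain ⟨hR, h'⟩ := h x
    obtain ⟨t, ht', hans⟩ := h' T b hb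
    refine ⟨t + T, b, ?_, hans, hPos.trans (positive_gtc_iff x)⟩
    set q := Q x.n
    have h1 : (t : ℝ) ≤ 2 ^ (C * (q + 1)) := by exact_mod_cast ht'.trans (hC q)
    have h2 : ((P.eval (gtc x).bitSize : ℕ) : ℝ) ≤ 2 ^ (D * (q + 1)) := by
      have h3 := hD q
      rw [Polynomial.eval_comp] at h3
      exact_mod_cast (Cmd.monotone_eval P hR).trans h3
    have h4 : (2 : ℝ) ^ τ x.n ≤ 2 ^ ‖τ x.n‖ :=
      Real.rpow_le_rpow_of_exponent_le (by norm_num) (le_abs_self _)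
    have h5 : (1 : ℝ) ≤ 2 ^ ‖τ x.n‖ := Real.one_le_rpow (by norm_num) (norm_nonneg _)
    have h6 : (T : ℝ) ≤ 2 ^ ‖τ x.n‖ * 2 ^ (D * (q + 1)) :=
      (hT.trans (ht x)).trans (mul_le_mul h4 h2 (by positivity) (by positivity))
    have h7 : (2 : ℝ) ^ (C * (q + 1)) ≤ 2 ^ ((C + D) * (q + 1)) :=
      pow_le_pow_right₀ (by norm_num) (Nat.mul_le_mul_right _ (by omega))
    have h8 : (2 : ℝ) ^ (D * (q + 1)) ≤ 2 ^ ((C + D) * (q + 1)) :=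
      pow_le_pow_right₀ (by norm_num) (Nat.mul_le_mul_right _ (by omega))
    have h9 : (2 : ℝ) * 2 ^ ((C + D) * (q + 1)) ≤ 2 ^ ((C + D + 1) * (q + 1)) := by
      rw [← pow_succ']
      exact pow_le_pow_right₀ (by norm_num) (by ring_nf; omega)
    have h10 : (2 : ℝ) ^ ((C + D + 1 : ℕ) * ((q : ℝ) + 1) + ‖τ x.n‖) =
        2 ^ ((C + D + 1) * (q + 1)) * 2 ^ ‖τ x.n‖ := by
      rw [Real.rpow_add (by norm_num), ← Real.rpow_natCast]
      push_cast
      rfl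
    refine le_trans ?_ h10.ge
    push_cast
    have h11 : (0 : ℝ) < 2 ^ ((C + D) * (q + 1)) := by positivity
    calc (t : ℝ) + T ≤ 2 ^ ((C + D) * (q + 1)) * 2 ^ ‖τ x.n‖ +
          2 ^ ‖τ x.n‖ * 2 ^ ((C + D) * (q + 1)) := by
          refine add_le_add ?_ (h6.trans (by gcongr))
          nlinarith
      _ = 2 * 2 ^ ((C + D) * (q + 1)) * 2 ^ ‖τ x.n‖ := by ring
      _ ≤ _ := mul_le_mul_of_nonneg_right h9 (by positivity)

/-- Since p = A², eventually f(2p + 2) ≤ √(2p + 2) / 4 ≤ A / 2. Then 2^f is at most (√2)^A, which is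
o(2^A), and 2^A = O(n). -/
theorem two_rpow_isLittleO {f : ℕ → ℝ} (hf : f =o[atTop] fun n : ℕ => Real.sqrt n) :
    (fun n => (2 : ℝ) ^ f (2 * p n + 2)) =o[atTop] fun n => (n : ℝ) := by
  have h2 : Real.sqrt 2 < 2 := by
    rw [Real.sqrt_lt' (by norm_num)]
    norm_num
  refine IsBigO.trans_isLittleO ?_
    (isLittleO_of_A (isLittleO_pow_pow_of_lt_left (Real.sqrt_nonneg 2) h2))
  have hp : Tendsto (fun n => 2 * p n + 2) atTop atTop :=
    tendsto_atTop_mono (fun n => by have := A_le_p n; omega) tendsto_A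
  refine IsBigO.of_bound 1 ((hp.eventually (hf.bound (show (0 : ℝ) < 1 / 4 by norm_num))).mono
    fun n hn => ?_)
  rw [Real.norm_of_nonneg (by positivity), Real.norm_of_nonneg (by positivity), one_mul,
    Real.sqrt_eq_rpow, ← Real.rpow_natCast, ← Real.rpow_mul (by norm_num)]
  refine Real.rpow_le_rpow_of_exponent_le (by norm_num) ?_
  have hA : (4 : ℝ) ≤ A n := by exact_mod_cast four_le_A n
  have h3 : Real.sqrt ((2 * p n + 2 : ℕ) : ℝ) ≤ 2 * A n := by
    rw [Real.sqrt_le_left (by positivity)]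
    push_cast [p]
    nlinarith
  rw [Real.norm_of_nonneg (Real.sqrt_nonneg _)] at hn
  have := le_abs_self (f (2 * p n + 2))
  rw [Real.norm_eq_abs] at hn
  linarith

theorem log_S (n : ℕ) : Real.log (S n) = A n * E n * Real.log 2 := by
  rw [S, N, ← pow_mul]
  push_cast
  rw [Real.log_pow]
  push_cast
  ring

theorem le_log_S (n : ℕ) : (A n * E n : ℝ) / 4 ≤ Real.log ((S n - 1 : ℕ) : ℝ) := by
  have h0 : 2 ≤ S n := le_trans (by have := Nat.one_le_two_pow (n := m n); omega) (two_mul_le_S n)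
  have h1 : (S n : ℝ) / 2 ≤ ((S n - 1 : ℕ) : ℝ) := by
    rw [Nat.cast_sub (by omega)]
    have : (2 : ℝ) ≤ S n := by exact_mod_cast h0
    push_cast
    linarith
  have h2 : 0 < (S n : ℝ) / 2 := by positivity
  refine le_trans ?_ (Real.log_le_log h2 h1)
  rw [Real.log_div (by positivity) (by norm_num), log_S]
  have h3 : (4 : ℝ) ≤ A n := by exact_mod_cast four_le_A n
  have h4 : (1 : ℝ) ≤ E n := by
    have : 1 ≤ E n := by rw [E]; omega
    exact_mod_cast this
  have h5 : (4 : ℝ) ≤ A n * E n := by nlinarith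
  have h6 := Real.log_two_gt_d9
  nlinarith

/-- By `le_log_S` it suffices that e^(A/4) ≤ A E / 4. From A² m ≥ 2^A follows A² E ≥ 2 · 2^A, and A
e^(A/4) is eventually at most 2^A / 2 because e^(1/4) < 2. -/
theorem eventually_le_log_log_S :
    ∀ᶠ n in atTop, (A n : ℝ) / 4 ≤ Real.log (Real.log ((S n - 1 : ℕ) : ℝ)) := by
  have h1 : ‖Real.exp (1 / 4)‖ < 2 := by
    rw [Real.norm_of_nonneg (Real.exp_pos _).le]
    refine lt_of_pow_lt_pow_left₀ 4 (by norm_num) ?_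
    rw [← Real.exp_nat_mul]
    norm_num
    linarith [Real.exp_one_lt_d9]
  have h2 := isLittleO_pow_const_mul_const_pow_const_pow_of_norm_lt 1 h1
  refine (tendsto_A.eventually (h2.bound (show (0 : ℝ) < 1 / 2 by norm_num))).mono fun n hn => ?_
  have hA : (4 : ℝ) ≤ A n := by exact_mod_cast four_le_A n
  have h3 : Real.exp (1 / 4) ^ A n = Real.exp (A n / 4) := by
    rw [← Real.exp_nat_mul]
    congr 1
    ring
  rw [h3, pow_one, Real.norm_of_nonneg (by positivity), Real.norm_of_nonneg (by positivity)] at hn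
  refine (Real.le_log_iff_exp_le ?_).2 ?_
  · refine lt_of_lt_of_le ?_ (le_log_S n)
    have h4 : (0 : ℝ) < E n := by
      have : 0 < E n := by rw [E]; omega
      exact_mod_cast this
    positivity
  · refine le_trans ?_ (le_log_S n)
    have h4 : 2 ^ A n ≤ A n * A n * m n :=
      (Nat.lt_mul_div_succ (N n) (show 0 < p n by have := sixteen_le_p n; omega)).le
    have h5 : A n * A n * m n * 2 ≤ A n * A n * E n := by
      rw [mul_assoc _ (m n)]
      exact Nat.mul_le_mul_left _ (by rw [E]; omega)
    have h6 : (2 : ℝ) ^ A n * 2 ≤ A n * A n * E n := by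
      exact_mod_cast (Nat.mul_le_mul_right 2 h4).trans h5
    have h7 : (A n : ℝ) * Real.exp (A n / 4) ≤ A n * (A n * E n / 4) := by nlinarith
    exact le_of_mul_le_mul_left h7 (by linarith)

/-- The squared double logarithm, at least (A/4)², cancels the O(A²) vertices, so the product is O(A
E) = O(Q). The decay relative to n then comes from `Q_isLittleO`. -/
theorem mul_isLittleO {f : ℕ → ℝ}
    (hf : f =o[atTop] fun l : ℕ => Real.log l / (Real.log (Real.log l)) ^ 2) :
    (fun n => ((2 * p n + 2 : ℕ) : ℝ) * f (S n - 1)) =o[atTop] fun n => (n : ℝ) := by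
  refine IsBigO.trans_isLittleO ?_ Q_isLittleO
  have hS : Tendsto (fun n => S n - 1) atTop atTop :=
    tendsto_atTop_mono (fun n => by
      have h1 := N_pow_le_S n
      have h2 := lt_N n
      have h3 := Nat.le_self_pow (n := 4) (by norm_num) (N n)
      change n ≤ _
      omega) tendsto_id
  refine IsBigO.of_bound 64 (((hS.eventually (hf.bound one_pos)).and
    eventually_le_log_log_S).mono fun n ⟨hn, hl⟩ => ?_)
  have hA : (4 : ℝ) ≤ A n := by exact_mod_cast four_le_A n
  have h0 := le_log_S n
  have h1 : Real.log ((S n - 1 : ℕ) : ℝ) ≤ A n * E n := by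
    have h2 : 0 < S n - 1 := by
      have := two_mul_le_S n
      have := Nat.one_le_two_pow (n := m n)
      omega
    refine (Real.log_le_log (by exact_mod_cast h2)
      (show ((S n - 1 : ℕ) : ℝ) ≤ S n by exact_mod_cast Nat.sub_le _ _)).trans ?_
    rw [log_S]
    have := Real.log_two_lt_d9
    exact mul_le_of_le_one_right (by positivity) (by linarith)
  rw [one_mul, Real.norm_of_nonneg (div_nonneg (le_trans (by positivity) h0) (sq_nonneg _))] at hn
  have h2 : ‖f (S n - 1)‖ ≤ A n * E n / (A n / 4) ^ 2 := hn.trans (by gcongr)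
  have h3 : ((2 * p n + 2 : ℕ) : ℝ) ≤ 4 * (A n) ^ 2 := by
    push_cast [p]
    nlinarith
  rw [norm_mul, Real.norm_of_nonneg (Nat.cast_nonneg _), Real.norm_of_nonneg (Nat.cast_nonneg _)]
  calc ((2 * p n + 2 : ℕ) : ℝ) * ‖f (S n - 1)‖ ≤
      4 * (A n) ^ 2 * (A n * E n / (A n / 4) ^ 2) :=
        mul_le_mul h3 h2 (norm_nonneg _) (by positivity)
    _ = 64 * (A n * E n) := by
      field_simp
      ring
    _ ≤ 64 * Q n := by
      rw [Q]
      push_cast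
      nlinarith

end Red

theorem mainTheorem7 (h : GTCSolvableDoubleExp ∨ GTCSolvableBounded) : DSSolvableSubexp := by
  rcases h with ⟨M, f, P, hf, hM⟩ | ⟨M, f, P, hf, hM⟩
  · exact Red.dsSolvable_of_le hM (Red.two_rpow_isLittleO hf) fun x => le_rfl
  · refine Red.dsSolvable_of_le (P := P) hM (Red.mul_isLittleO hf) fun x => ?_
    rw [Red.bound_gtc]
    exact le_rfl
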